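/- Let $S$ be a compact, connected, oriented surface, possibly with boundary, with $\chi(S)<0$, and let $h$ be a hyperbolic metric on $S$ (curvature $-1$) with geodesic boundary. Write $S=\tilde S/\pi$, where $\pi=\pi_1(S)$ and the universal cover $\tilde S$ is identified with a closed convex subset of the hyperbolic plane $\mathbb{H}^2$ bounded by geodesics. Let $\partial_\infty\tilde S\subset\partial\mathbb{H}^2$ be the set of points at infinity in the closure of $\tilde S$, and let $\mathcal G(\tilde S)$ be the space of unordered pairs of distinct points of $\partial_\infty\tilde S$, i.e. of bi-infinite geodesics of $\tilde S$. A geodesic current on $S$ is a $\pi$-invariant locally finite Borel measure $c$ on $\mathcal G(\tilde S)$. It is internal if $c(\{\tilde\beta\})=0$ for every lift $\tilde\beta\in\mathcal G(\tilde S)$ of a component of $\partial S$. Let $\widetilde{\operatorname{supp}}(c)\subset\mathcal G(\tilde S)$ be the support of the measure, and let $\operatorname{supp}_h(c)\subset S$ be the union of the projections to $S$ of the geodesics in $\widetilde{\operatorname{supp}}(c)$. Two geodesics of $S$ are asymptotic if they have lifts to $\tilde S$ with a common endpoint in $\partial_\infty\tilde S$. Let $c\neq 0$ be an internal geodesic current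 on $S$. Then there is a geodesic $\tilde\eta\in\widetilde{\operatorname{supp}}(c)$ whose projection $\eta\subseteq\operatorname{supp}_h(c)$ to $S$ is not a boundary curve of $S$ and is not asymptotic to any boundary curve of $S$. -/

import Mathlib

open Filter Topology MeasureTheory
open scoped UpperHalfPlane MatrixGroups

/-! ### The hyperbolic plane and its circle at infinity -/

/-- The inclusion of the hyperbolic plane (upper half-plane) into the Riemann sphere. -/
noncomputable def hypToSphere (z : ℍ) : OnePoint ℂ := ((z : ℂ) : OnePoint ℂ)

/-- The inclusion of the circle at infinity `ℝ ∪ {∞}` into the Riemann sphere. The closure of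
`ℍ` in the sphere is the closed disc `ℍ ∪ ℝ ∪ {∞}`. -/
noncomputable def circleToSphere (ξ : OnePoint ℝ) : OnePoint ℂ :=
  OnePoint.map Complex.ofReal ξ

/-- The isometry (Moebius transformation) given by `γ ∈ SL(2, ℝ)`, acting on the circle at
infinity. -/
noncomputable def moebiusAtInfinity (γ : SL(2, ℝ)) (ξ : OnePoint ℝ) : OnePoint ℝ :=
  (γ : GL (Fin 2) ℝ) • ξ

/-- `ξ` is one of the two endpoints at infinity of the path `σ` in the hyperbolic plane. -/
def IsEndAtInfinity (σ : ℝ → ℍ) (ξ : OnePoint ℝ) : Prop :=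
  Tendsto (fun t => hypToSphere (σ t)) atTop (𝓝 (circleToSphere ξ)) ∨
    Tendsto (fun t => hypToSphere (σ t)) atBot (𝓝 (circleToSphere ξ))

/-- `σ` is a (unit speed, bi-infinite) hyperbolic geodesic whose unordered pair of endpoints at
infinity is `p`. -/
def IsGeodesicWithEnds (σ : ℝ → ℍ) (p : Sym2 (OnePoint ℝ)) : Prop :=
  Isometry σ ∧ ∃ ξ η : OnePoint ℝ, p = s(ξ, η) ∧
    Tendsto (fun t => hypToSphere (σ t)) atBot (𝓝 (circleToSphere ξ)) ∧
    Tendsto (fun t => hypToSphere (σ t)) atTop (𝓝 (circleToSphere η))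

/-! ### Hyperbolic surfaces with geodesic boundary -/

/-- A (complete, oriented) hyperbolic metric with geodesic boundary on the connected surface `S`,
given by its universal Riemannian covering: a closed convex subset `cover` of the hyperbolic plane
with geodesic boundary, a group `deck` of orientation preserving isometries of `ℍ` preserving it,
and a covering map `proj : cover → S` whose fibres are the orbits of `deck`.
(As `cover` is simply connected, the image of `deck` in `PSL(2, ℝ)` is the group of deck
transformations, that is, the fundamental group of `S`; it acts freely because `proj` is locally
injective. When `S` is compact its Euler characteristic is negative, by Gauss-Bonnet.) -/
structure HyperbolicMetric (S : Type*) [TopologicalSpace S] where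
  /-- The universal cover, as a subset of the hyperbolic plane. -/
  cover : Set ℍ
  nonempty_cover : cover.Nonempty
  isClosed_cover : IsClosed cover
  /-- Geodesic convexity: `cover` contains the geodesic segment between any two of its points. -/
  convex_cover : ∀ x ∈ cover, ∀ y ∈ cover, ∀ z : ℍ,
    dist x z + dist z y = dist x y → z ∈ cover
  /-- Geodesic boundary: near a point that is not interior, `cover` coincides with a closed
  half-plane `{z | dist z a ≤ dist z b}` whose bounding geodesic passes through the point. -/
  geodesic_boundary : ∀ x ∈ cover, x ∈ interior cover ∨
    ∃ a b : ℍ, a ≠ b ∧ dist x a = dist x b ∧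
      ∀ᶠ z in 𝓝 x, (z ∈ cover ↔ dist z a ≤ dist z b)
  /-- The group of deck transformations. -/
  deck : Subgroup SL(2, ℝ)
  smul_mem_cover : ∀ γ ∈ deck, ∀ x ∈ cover, γ • x ∈ cover
  /-- The universal covering map. -/
  proj : cover → S
  isCoveringMap_proj : IsCoveringMap proj
  surjective_proj : Function.Surjective proj
  proj_eq_iff : ∀ x y : cover, proj x = proj y ↔ ∃ γ ∈ deck, γ • (x : ℍ) = (y : ℍ)

namespace HyperbolicMetric

variable {S : Type*} [TopologicalSpace S]

/-- The ideal boundary of the universal cover: the points at infinity in the closure of the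
universal cover. -/
def idealBoundary (h : HyperbolicMetric S) : Set (OnePoint ℝ) :=
  {ξ | circleToSphere ξ ∈ closure (hypToSphere '' h.cover)}

/-- The space of bi-infinite geodesics of the universal cover: unordered pairs of distinct points
of its ideal boundary. -/
def Geodesics (h : HyperbolicMetric S) : Type :=
  {p : Sym2 (OnePoint ℝ) // ¬ p.IsDiag ∧ ∀ ξ ∈ p, ξ ∈ h.idealBoundary}

/-- The topology on the space of geodesics: unordered pairs carry the quotient topology of the
product topology on ordered pairs. -/
instance (h : HyperbolicMetric S) : TopologicalSpace h.Geodesics :=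
  TopologicalSpace.induced Subtype.val
    (TopologicalSpace.coinduced (fun q : OnePoint ℝ × OnePoint ℝ => s(q.1, q.2)) inferInstance)

/-- The Borel σ-algebra. -/
instance (h : HyperbolicMetric S) : MeasurableSpace h.Geodesics := borel h.Geodesics

instance (h : HyperbolicMetric S) : BorelSpace h.Geodesics := ⟨rfl⟩

/-- The boundary of `S`: the image of the topological frontier of the universal cover. -/
def boundary (h : HyperbolicMetric S) : Set S :=
  h.proj '' {x | (x : ℍ) ∈ frontier h.cover}

/-- `σ` is a bi-infinite geodesic of the universal cover that lifts the curve `η` in `S`. -/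
def IsGeodesicLift (h : HyperbolicMetric S) (σ : ℝ → h.cover) (η : ℝ → S) : Prop :=
  Isometry σ ∧ ∀ t, h.proj (σ t) = η t

/-- A (parametrized) boundary curve of `S`: a bi-infinite geodesic of `S` contained in the
boundary of `S`, so that it wraps around one boundary component. -/
def IsBoundaryCurve (h : HyperbolicMetric S) (η : ℝ → S) : Prop :=
  (∃ σ, h.IsGeodesicLift σ η) ∧ Set.range η ⊆ h.boundary

/-- Two geodesics of `S` are asymptotic to each other (in one of their two directions each) if
they have lifts to the universal cover with a common endpoint at infinity. -/
def Asymptotic (h : HyperbolicMetric S) (η η' : ℝ → S) : Prop :=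
  ∃ σ σ', h.IsGeodesicLift σ η ∧ h.IsGeodesicLift σ' η' ∧
    ∃ ξ : OnePoint ℝ, IsEndAtInfinity (fun t => σ t) ξ ∧ IsEndAtInfinity (fun t => σ' t) ξ

/-- `η` is the curve in `S` obtained by projecting (a parametrization of) the geodesic of the
universal cover with pair of endpoints `p`. -/
def IsProjectionOf (h : HyperbolicMetric S) (η : ℝ → S) (p : h.Geodesics) : Prop :=
  ∃ σ, h.IsGeodesicLift σ η ∧ IsGeodesicWithEnds (fun t => σ t) p.val

end HyperbolicMetric

/-! ### Geodesic currents -/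

/-- A geodesic current: a locally finite Borel measure on the space of geodesics of the universal
cover that is invariant under the fundamental group. -/
structure GeodesicCurrent {S : Type*} [TopologicalSpace S] (h : HyperbolicMetric S) where
  measure : Measure h.Geodesics
  locallyFinite : IsLocallyFiniteMeasure measure
  /-- If the Borel set `B` is the translate `γ A` of the Borel set `A` by a deck transformation,
  then `A` and `B` have the same measure. -/
  invariant : ∀ γ ∈ h.deck, ∀ A B : Set h.Geodesics, MeasurableSet A → MeasurableSet B →
    (Subtype.val '' B : Set (Sym2 (OnePoint ℝ))) =
      Sym2.map (moebiusAtInfinity γ) '' (Subtype.val '' A) →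
    measure B = measure A

namespace GeodesicCurrent

variable {S : Type*} [TopologicalSpace S] {h : HyperbolicMetric S}

/-- The current is internal: no lift of a boundary curve is an atom. -/
def IsInternal (c : GeodesicCurrent h) : Prop :=
  ∀ (η : ℝ → S) (p : h.Geodesics), h.IsBoundaryCurve η → h.IsProjectionOf η p →
    c.measure {p} = 0

/-- The support of the current in `S`: the union of the projections to `S` of all the geodesics
of the universal cover that lie in the support of the measure. -/
def supp (c : GeodesicCurrent h) : Set S :=
  {s | ∃ p ∈ c.measure.support, ∃ η, h.IsProjectionOf η p ∧ s ∈ Set.range η}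

end GeodesicCurrent

/-! ### Moebius transformations of the sphere are continuous -/

section Ratio

variable {K : Type*} [NontriviallyNormedField K]

/-! A geodesic asymptotic to a boundary curve has a lift sharing an endpoint with a line in the
frontier of the universal cover. The proof shows that an internal current gives measure zero to the
set of all geodesics with such an endpoint.

There are only countably many such endpoints (`countable_frontierEnds`): near each of its points the
frontier lies on a single geodesic, and countably many of these neighbourhoods suffice.

For a single endpoint the argument is dynamical. Since `S` is compact, a frontier line keeps
returning close to itself modulo the deck group, so some deck transformation translates it along
itself (`exists_deck_translation`). Put the ends of the line at `0` and `∞`; this transformation, or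
its inverse, acts at infinity as `x ↦ c x` with `0 < c < 1` (`exists_deck_homothety`). The geodesics
from `∞` to `[-r, r]` therefore have the same measure as those from `∞` to `[-cⁿ r, cⁿ r]`. These
sets decrease to the frontier line itself and eventually lie in a neighbourhood of finite measure,
so their common measure is that of the line, which is zero for an internal current (`measure_fan`,
`measure_pencil`).

The complement of the support is null too, by second countability. A nonzero current thus has a
support geodesic with neither end among the frontier ends. It is not a boundary curve either, since
every geodesic is asymptotic to itself. -/

lemma exists_norm_lt_imp_mem_of_mem_nhds_infty [ProperSpace K] {s : Set (OnePoint K)}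
    (hs : s ∈ 𝓝 (OnePoint.infty : OnePoint K)) :
    OnePoint.infty ∈ s ∧ ∃ R : ℝ, ∀ x : K, R < ‖x‖ → (x : OnePoint K) ∈ s := by
  refine ⟨mem_of_mem_nhds hs, ?_⟩
  have h1 : ((↑) : K → OnePoint K) ⁻¹' s ∈ cocompact K := by
    have := (OnePoint.tendsto_coe_infty (X := K)) hs
    rwa [coclosedCompact_eq_cocompact] at this
  rw [← Metric.cobounded_eq_cocompact, ← comap_norm_atTop] at h1
  obtain ⟨t, ht, hts⟩ := h1
  obtain ⟨R, hR⟩ := mem_atTop_sets.1 ht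
  exact ⟨R, fun x hx => hts (hR _ hx.le)⟩

variable [DecidableEq K]

/-- The point of the projective line with homogeneous coordinates `p`. -/
def projRatio (p : K × K) : OnePoint K :=
  if p.2 = 0 then OnePoint.infty else ((p.1 / p.2 : K) : OnePoint K)

lemma gl_smul_coe (g : GL (Fin 2) K) (x : K) :
    g • (x : OnePoint K) = projRatio (g 0 0 * x + g 0 1, g 1 0 * x + g 1 1) := by
  rw [OnePoint.smul_some_eq_ite]; rfl

lemma gl_smul_infty (g : GL (Fin 2) K) :
    g • (OnePoint.infty : OnePoint K) = projRatio (g 0 0, g 1 0) := by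
  rw [OnePoint.smul_infty_eq_ite]; rfl

variable [ProperSpace K]

/-- Homogeneous coordinates treat finite points and poles alike, so continuity of a Moebius map
reduces to this one statement. Near `(n, 0)` the numerator dominates any fixed multiple of the
denominator, which forces the quotient to infinity. -/
lemma continuousAt_projRatio {p : K × K} (hp : p ≠ 0) : ContinuousAt (projRatio (K := K)) p := by
  obtain ⟨n, d⟩ := p
  by_cases hd : d = 0
  · subst hd
    have hn : n ≠ 0 := fun h => hp (by simp [h])
    have hval : projRatio ((n, 0) : K × K) = OnePoint.infty := by simp [projRatio]
    rw [ContinuousAt, hval, tendsto_def]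
    intro s hs
    obtain ⟨hinf, R, hR⟩ := exists_norm_lt_imp_mem_of_mem_nhds_infty hs
    have hlim : Tendsto (fun q : K × K => (|R| + 1) * ‖q.2‖ - ‖q.1‖) (𝓝 (n, 0))
        (𝓝 ((|R| + 1) * ‖(0 : K)‖ - ‖n‖)) :=
      Continuous.tendsto (f := fun q : K × K => (|R| + 1) * ‖q.2‖ - ‖q.1‖) (by fun_prop) (n, 0)
    have hneg : (|R| + 1) * ‖(0 : K)‖ - ‖n‖ < 0 := by simpa using hn
    filter_upwards [hlim.eventually_lt_const hneg] with q hq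
    show projRatio q ∈ s
    unfold projRatio
    split_ifs with h0
    · exact hinf
    · apply hR
      have h0' : 0 < ‖q.2‖ := norm_pos_iff.2 h0
      rw [norm_div, lt_div_iff₀ h0']
      nlinarith [le_abs_self R]
  · have hev : ∀ᶠ q : K × K in 𝓝 (n, d),
        projRatio q = ((q.1 / q.2 : K) : OnePoint K) := by
      have : ∀ᶠ q : K × K in 𝓝 (n, d), q.2 ≠ 0 :=
        (continuous_snd.tendsto (n, d)).eventually_ne hd
      filter_upwards [this] with q hq
      simp [projRatio, hq]
    refine ContinuousAt.congr ?_ (hev.mono fun _ h => h.symm)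
    exact OnePoint.continuous_coe.continuousAt.comp
      (ContinuousAt.div continuousAt_fst continuousAt_snd hd)

theorem continuous_gl_smul_onePoint (g : GL (Fin 2) K) :
    Continuous fun x : OnePoint K => g • x := by
  have hdet : g 0 0 * g 1 1 - g 0 1 * g 1 0 ≠ 0 := by
    have := g.det_ne_zero
    rwa [Matrix.det_fin_two] at this
  rw [OnePoint.continuous_iff]
  constructor
  · rw [gl_smul_infty, coclosedCompact_eq_cocompact, ← Metric.cobounded_eq_cocompact]
    -- Dividing both homogeneous coordinates by `z` leaves the ratio unchanged and makes it
    -- continuous in `z⁻¹`, which tends to `0`.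
    have hev : (fun z : K => projRatio (g 0 0 + g 0 1 * z⁻¹, g 1 0 + g 1 1 * z⁻¹))
        =ᶠ[Bornology.cobounded K] fun z : K => g • (z : OnePoint K) := by
      filter_upwards [(Metric.hasBasis_cobounded_compl_closedBall (0 : K)).mem_of_mem trivial
        (i := 0)] with z hz
      have hz : z ≠ 0 := by simpa using hz
      rw [gl_smul_coe]
      unfold projRatio
      have e1 : g 1 0 + g 1 1 * z⁻¹ = (g 1 0 * z + g 1 1) / z := by field_simp
      have e0 : g 0 0 + g 0 1 * z⁻¹ = (g 0 0 * z + g 0 1) / z := by field_simp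
      simp only [e0, e1, div_eq_zero_iff, hz, or_false]
      rw [div_div_div_cancel_right₀ hz]
    refine Tendsto.congr' hev ?_
    have h1 : ((g 0 0, g 1 0) : K × K) ≠ 0 := by
      intro h
      simp only [Prod.mk_eq_zero] at h
      simp [h.1, h.2] at hdet
    refine (continuousAt_projRatio h1).tendsto.comp ?_
    have h2 : Tendsto (fun z : K => z⁻¹) (Bornology.cobounded K) (𝓝 0) :=
      tendsto_inv₀_cobounded
    refine Tendsto.prodMk_nhds ?_ ?_
    · simpa using (h2.const_mul (g 0 1)).const_add (g 0 0)
    · simpa using (h2.const_mul (g 1 1)).const_add (g 1 0)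
  · refine continuous_iff_continuousAt.2 fun x => ?_
    simp only [gl_smul_coe]
    have h1 : ((g 0 0 * x + g 0 1, g 1 0 * x + g 1 1) : K × K) ≠ 0 := by
      intro h
      simp only [Prod.mk_eq_zero] at h
      apply hdet
      linear_combination (g 0 0) * h.2 - g 1 0 * h.1
    exact ContinuousAt.comp (f := fun x : K => (g 0 0 * x + g 0 1, g 1 0 * x + g 1 1))
      (continuousAt_projRatio h1) (by fun_prop)

end Ratio

/-! ### The action of `SL(2, ℝ)` on the closed disc -/

/-- A real Moebius transformation as a transformation of the Riemann sphere. -/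
noncomputable def complexify (γ : SL(2, ℝ)) : GL (Fin 2) ℂ :=
  (γ : GL (Fin 2) ℝ).map Complex.ofRealHom

lemma hypToSphere_smul (γ : SL(2, ℝ)) (z : ℍ) :
    hypToSphere (γ • z) = complexify γ • hypToSphere z := by
  unfold hypToSphere
  rw [OnePoint.smul_some_eq_ite, UpperHalfPlane.specialLinearGroup_apply]
  have h := UpperHalfPlane.denom_ne_zero (γ : GL (Fin 2) ℝ) z
  rw [if_neg]
  · simp [complexify]
  · simpa [complexify, UpperHalfPlane.denom] using h

lemma circleToSphere_smul (γ : SL(2, ℝ)) (ξ : OnePoint ℝ) :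
    circleToSphere (moebiusAtInfinity γ ξ) = complexify γ • circleToSphere ξ :=
  OnePoint.map_smul Complex.ofRealHom _ ξ

lemma circleToSphere_injective : Function.Injective circleToSphere :=
  Option.map_injective Complex.ofReal_injective

lemma Filter.Tendsto.hypToSphere_smul {α : Type*} {l : Filter α} {f : α → ℍ} {ξ : OnePoint ℝ}
    (γ : SL(2, ℝ)) (h : Tendsto (fun t => hypToSphere (f t)) l (𝓝 (circleToSphere ξ))) :
    Tendsto (fun t => hypToSphere (γ • f t)) l (𝓝 (circleToSphere (moebiusAtInfinity γ ξ))) := by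
  rw [circleToSphere_smul]
  simp only [_root_.hypToSphere_smul]
  exact ((continuous_gl_smul_onePoint (complexify γ)).tendsto _).comp h

@[simp] lemma moebiusAtInfinity_one (ξ : OnePoint ℝ) : moebiusAtInfinity 1 ξ = ξ := by
  simp [moebiusAtInfinity]

lemma moebiusAtInfinity_mul (γ δ : SL(2, ℝ)) (ξ : OnePoint ℝ) :
    moebiusAtInfinity (γ * δ) ξ = moebiusAtInfinity γ (moebiusAtInfinity δ ξ) := by
  simp [moebiusAtInfinity, mul_smul]

@[simp] lemma moebiusAtInfinity_inv_self (γ : SL(2, ℝ)) (ξ : OnePoint ℝ) :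
    moebiusAtInfinity γ⁻¹ (moebiusAtInfinity γ ξ) = ξ := by
  rw [← moebiusAtInfinity_mul]; simp

@[simp] lemma moebiusAtInfinity_self_inv (γ : SL(2, ℝ)) (ξ : OnePoint ℝ) :
    moebiusAtInfinity γ (moebiusAtInfinity γ⁻¹ ξ) = ξ := by
  rw [← moebiusAtInfinity_mul]; simp

lemma moebiusAtInfinity_injective (γ : SL(2, ℝ)) : Function.Injective (moebiusAtInfinity γ) :=
  Function.LeftInverse.injective (moebiusAtInfinity_inv_self γ)

lemma continuous_moebiusAtInfinity (γ : SL(2, ℝ)) : Continuous (moebiusAtInfinity γ) :=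
  continuous_gl_smul_onePoint (γ : GL (Fin 2) ℝ)

lemma moebiusAtInfinity_coe (γ : SL(2, ℝ)) (x : ℝ) :
    moebiusAtInfinity γ (x : OnePoint ℝ) = if γ 1 0 * x + γ 1 1 = 0 then OnePoint.infty
      else ((γ 0 0 * x + γ 0 1) / (γ 1 0 * x + γ 1 1) : ℝ) := by
  exact OnePoint.smul_some_eq_ite

lemma moebiusAtInfinity_infty (γ : SL(2, ℝ)) :
    moebiusAtInfinity γ OnePoint.infty = if γ 1 0 = 0 then OnePoint.infty
      else ((γ 0 0 / γ 1 0 : ℝ) : OnePoint ℝ) := by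
  exact OnePoint.smul_infty_eq_ite _

/-- The element of `SL(2, ℝ)` with given entries. -/
def sl2OfEntries (a b c d : ℝ) (h : a * d - b * c = 1) : SL(2, ℝ) :=
  ⟨Matrix.of ![![a, b], ![c, d]], by rw [Matrix.det_fin_two]; exact h⟩

section
variable {a b c d : ℝ} (h : a * d - b * c = 1)

@[simp] lemma sl2OfEntries_zero_zero : sl2OfEntries a b c d h 0 0 = a := rfl
@[simp] lemma sl2OfEntries_zero_one : sl2OfEntries a b c d h 0 1 = b := rfl
@[simp] lemma sl2OfEntries_one_zero : sl2OfEntries a b c d h 1 0 = c := rfl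
@[simp] lemma sl2OfEntries_one_one : sl2OfEntries a b c d h 1 1 = d := rfl

end

/-- Moebius transformations act transitively on ordered pairs of distinct points. -/
lemma exists_moebiusAtInfinity_zero_infty {ξ η : OnePoint ℝ} (h : ξ ≠ η) :
    ∃ g : SL(2, ℝ), moebiusAtInfinity g ((0 : ℝ) : OnePoint ℝ) = ξ ∧
      moebiusAtInfinity g OnePoint.infty = η := by
  induction ξ using OnePoint.rec with
  | infty =>
    induction η using OnePoint.rec with
    | infty => exact absurd rfl h
    | coe y =>
      refine ⟨sl2OfEntries y (-1) 1 0 (by ring), ?_, ?_⟩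
      · simp [moebiusAtInfinity_coe]
      · simp [moebiusAtInfinity_infty]
  | coe x =>
    induction η using OnePoint.rec with
    | infty =>
      refine ⟨sl2OfEntries 1 x 0 1 (by ring), ?_, ?_⟩
      · simp [moebiusAtInfinity_coe]
      · simp [moebiusAtInfinity_infty]
    | coe y =>
      have hxy : y - x ≠ 0 := fun h' => h (by rw [sub_eq_zero.1 h'])
      refine ⟨sl2OfEntries y (x * (y - x)⁻¹) 1 (y - x)⁻¹ (by field_simp), ?_, ?_⟩
      · simp [moebiusAtInfinity_coe, hxy]
      · simp [moebiusAtInfinity_infty]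

/-! ### Isometric lines in the hyperbolic plane -/

/-- The unit speed geodesic from `0` to `∞`. -/
noncomputable def axis (t : ℝ) : ℍ := ⟨⟨0, Real.exp t⟩, Real.exp_pos t⟩

@[simp] lemma axis_re (t : ℝ) : (axis t).re = 0 := rfl

@[simp] lemma axis_im (t : ℝ) : (axis t).im = Real.exp t := rfl

lemma isometry_axis : Isometry axis := UpperHalfPlane.isometry_vertical_line 0

lemma isometry_smul_axis (g : SL(2, ℝ)) : Isometry fun t => g • axis t :=
  (isometry_smul ℍ g).comp isometry_axis

lemma eq_axis_of_re_eq_zero {z : ℍ} (h : z.re = 0) : z = axis (Real.log z.im) :=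
  UpperHalfPlane.ext_re_im (by simp [h]) (by simp [Real.exp_log z.im_pos])

/-- After clearing denominators, `cosh` of the distance to a fixed point is affine in `(re z,
|z|²)`. The computations with bisectors and segments below rest on this. -/
lemma two_mul_im_mul_im_mul_cosh_dist (z w : ℍ) :
    2 * z.im * w.im * Real.cosh (dist z w) =
      (z.re ^ 2 + z.im ^ 2) + (w.re ^ 2 + w.im ^ 2) - 2 * z.re * w.re := by
  rw [UpperHalfPlane.cosh_dist']
  have := z.im_pos.ne'
  have := w.im_pos.ne'
  field_simp
  ring

lemma two_mul_im_mul_cosh_dist_axis (w : ℍ) (t : ℝ) :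
    2 * w.im * Real.exp t * Real.cosh (dist w (axis t)) =
      w.re ^ 2 + w.im ^ 2 + Real.exp t ^ 2 := by
  simpa using two_mul_im_mul_im_mul_cosh_dist w (axis t)

lemma eq_axis_of_dist_eq {w : ℍ} {a b t : ℝ} (hab : a ≠ b)
    (ha : dist w (axis a) = |t - a|) (hb : dist w (axis b) = |t - b|) : w = axis t := by
  -- The relation is affine in `exp c ^ 2`; holding for two different values of `c`, it forces both
  -- coefficients to vanish.
  have key : ∀ c, dist w (axis c) = |t - c| →
      w.re ^ 2 + w.im ^ 2 - w.im * Real.exp t =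
        Real.exp c ^ 2 * (w.im * (Real.exp t)⁻¹ - 1) := by
    intro c hc
    have h := two_mul_im_mul_cosh_dist_axis w c
    rw [hc, Real.cosh_abs, Real.cosh_eq, neg_sub, Real.exp_sub, Real.exp_sub] at h
    have := (Real.exp_pos t).ne'
    have := (Real.exp_pos c).ne'
    field_simp at h ⊢
    linear_combination (-1 : ℝ) * h
  have h1 := key a ha
  have h2 := key b hb
  have hne : Real.exp a ^ 2 - Real.exp b ^ 2 ≠ 0 := by
    rw [sub_ne_zero]
    intro h
    exact hab (Real.exp_injective
      ((pow_left_inj₀ (Real.exp_pos a).le (Real.exp_pos b).le two_ne_zero).1 h))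
  have h3 : w.im * (Real.exp t)⁻¹ - 1 = 0 := by
    refine (mul_eq_zero.1 ?_).resolve_left hne
    linear_combination h2 - h1
  have him : w.im = Real.exp t := by
    have := (Real.exp_pos t).ne'
    field_simp at h3
    linarith
  have hre : w.re = 0 := by
    rw [h3, mul_zero, him] at h1
    have : w.re ^ 2 = 0 := by linarith
    simpa using this
  exact UpperHalfPlane.ext_re_im (by simp [hre]) (by simp [him])

/-- Two points of the line already lie on the imaginary axis, and the distances to them pin down
every other point. Only the direction of travel remains free. -/
lemma Isometry.eq_axis {σ : ℝ → ℍ} (hσ : Isometry σ) (h0 : (σ 0).re = 0) (h1 : (σ 1).re = 0) :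
    ∃ s : ℝ, (∀ t, σ t = axis (s + t)) ∨ ∀ t, σ t = axis (s - t) := by
  obtain ⟨a, ha⟩ : ∃ a, σ 0 = axis a := ⟨_, eq_axis_of_re_eq_zero h0⟩
  obtain ⟨b, hb⟩ : ∃ b, σ 1 = axis b := ⟨_, eq_axis_of_re_eq_zero h1⟩
  have hab : |a - b| = 1 := by
    have := hσ.dist_eq 0 1
    rw [ha, hb, isometry_axis.dist_eq, Real.dist_eq, Real.dist_eq] at this
    simpa using this
  have hd0 : ∀ t, dist (σ t) (axis a) = |t| := fun t => by
    rw [← ha, hσ.dist_eq, Real.dist_eq, sub_zero]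
  have hd1 : ∀ t, dist (σ t) (axis b) = |t - 1| := fun t => by
    rw [← hb, hσ.dist_eq, Real.dist_eq]
  have hne : a ≠ b := by rintro rfl; simp at hab
  refine ⟨a, ?_⟩
  rcases (abs_eq zero_le_one).1 hab with h | h
  · right
    intro t
    refine eq_axis_of_dist_eq hne ?_ ?_
    · rw [hd0, ← abs_neg]; congr 1; ring
    · rw [hd1, ← abs_neg]; congr 1; linarith
  · left
    intro t
    refine eq_axis_of_dist_eq hne ?_ ?_
    · rw [hd0]; congr 1; ring
    · rw [hd1]; congr 1; linarith

lemma smul_re (g : SL(2, ℝ)) (z : ℍ) : (g • z).re =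
    ((g 0 0 * z.re + g 0 1) * (g 1 0 * z.re + g 1 1) + g 0 0 * z.im * (g 1 0 * z.im)) /
      Complex.normSq (g 1 0 * z + g 1 1) := by
  rw [← UpperHalfPlane.coe_re, UpperHalfPlane.coe_specialLinearGroup_apply, Complex.div_re]
  simp [add_div]

lemma exists_smul_re_eq_zero (x y : ℍ) :
    ∃ g : SL(2, ℝ), (g • x).re = 0 ∧ (g • y).re = 0 := by
  by_cases h : x.re = y.re
  · refine ⟨sl2OfEntries 1 (-x.re) 0 1 (by ring), ?_, ?_⟩ <;> simp [smul_re, h]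
  have h' : x.re - y.re ≠ 0 := sub_ne_zero.2 h
  -- `c` and `R` are the centre and radius of the semicircle through `x` and `y` orthogonal to the
  -- real line. The matrix below sends its ends `c - R` and `c + R` to `0` and `∞`.
  set c : ℝ := (x.re ^ 2 + x.im ^ 2 - (y.re ^ 2 + y.im ^ 2)) / (2 * (x.re - y.re)) with hc
  have hc' : 2 * (x.re - y.re) * c = x.re ^ 2 + x.im ^ 2 - (y.re ^ 2 + y.im ^ 2) := by
    rw [hc]; field_simp
  set R : ℝ := √((x.re - c) ^ 2 + x.im ^ 2) with hR
  have hx := x.im_pos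
  have hpos : 0 < (x.re - c) ^ 2 + x.im ^ 2 := by positivity
  have hR0 : 0 < R := Real.sqrt_pos.2 hpos
  have hR2 : R ^ 2 = (x.re - c) ^ 2 + x.im ^ 2 := Real.sq_sqrt hpos.le
  refine ⟨sl2OfEntries (1 / (2 * R)) (-(1 / (2 * R)) * (c - R)) (-1) (c + R) ?_, ?_, ?_⟩
  · field_simp; ring
  · rw [smul_re]
    simp only [sl2OfEntries_zero_zero, sl2OfEntries_zero_one, sl2OfEntries_one_zero,
      sl2OfEntries_one_one]
    rw [div_eq_zero_iff]
    left
    linear_combination (1 / (2 * R)) * hR2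
  · rw [smul_re]
    simp only [sl2OfEntries_zero_zero, sl2OfEntries_zero_one, sl2OfEntries_one_zero,
      sl2OfEntries_one_one]
    rw [div_eq_zero_iff]
    left
    linear_combination (1 / (2 * R)) * hR2 - (1 / (2 * R)) * hc'

/-- The Moebius transformation translating `axis` by `s`. -/
noncomputable def axisShift (s : ℝ) : SL(2, ℝ) :=
  sl2OfEntries (Real.exp (s / 2)) 0 0 (Real.exp (s / 2))⁻¹
    (by have := (Real.exp_pos (s / 2)).ne'; field_simp; ring)

/-- The Moebius transformation reversing `axis`. -/
def axisFlip : SL(2, ℝ) := sl2OfEntries 0 (-1) 1 0 (by ring)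

lemma axisShift_smul (s t : ℝ) : axisShift s • axis t = axis (s + t) := by
  apply UpperHalfPlane.ext
  rw [UpperHalfPlane.coe_specialLinearGroup_apply]
  have h := (Real.exp_pos (s / 2)).ne'
  have h2 : Real.exp (s + t) = Real.exp (s / 2) * Real.exp (s / 2) * Real.exp t := by
    rw [← Real.exp_add, ← Real.exp_add]; congr 1; ring
  simp only [axisShift, sl2OfEntries_zero_zero, sl2OfEntries_zero_one, sl2OfEntries_one_zero,
      sl2OfEntries_one_one, Algebra.algebraMap_self_apply, axis, h2]
  generalize Real.exp (s / 2) = e at h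
  apply Complex.ext <;> simp
  field_simp

lemma axisFlip_smul (t : ℝ) : axisFlip • axis t = axis (-t) := by
  apply UpperHalfPlane.ext
  rw [UpperHalfPlane.coe_specialLinearGroup_apply]
  have h := (Real.exp_pos t).ne'
  simp only [axisFlip, sl2OfEntries_zero_zero, sl2OfEntries_zero_one, sl2OfEntries_one_zero,
      sl2OfEntries_one_one, Algebra.algebraMap_self_apply, axis]
  apply Complex.ext <;> simp [Complex.div_re, Complex.div_im, Complex.normSq_apply, Real.exp_neg]
  field_simp

/-- Every isometric line is a Moebius translate of `axis`. -/
lemma Isometry.exists_eq_smul_axis {σ : ℝ → ℍ} (hσ : Isometry σ) :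
    ∃ g : SL(2, ℝ), ∀ t, σ t = g • axis t := by
  obtain ⟨g, h0, h1⟩ := exists_smul_re_eq_zero (σ 0) (σ 1)
  obtain ⟨s, h | h⟩ := ((isometry_smul ℍ g).comp hσ).eq_axis h0 h1
  · refine ⟨g⁻¹ * axisShift s, fun t => ?_⟩
    rw [mul_smul, axisShift_smul, ← h]; simp
  · refine ⟨g⁻¹ * axisShift s * axisFlip, fun t => ?_⟩
    rw [mul_smul, mul_smul, axisFlip_smul, axisShift_smul, ← sub_eq_add_neg, ← h]; simp

lemma tendsto_axis_atTop :
    Tendsto (fun t => hypToSphere (axis t)) atTop (𝓝 (circleToSphere OnePoint.infty)) := by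
  have h : Tendsto (fun t => ((axis t : ℍ) : ℂ)) atTop (cocompact ℂ) := by
    rw [← Metric.cobounded_eq_cocompact, ← tendsto_norm_atTop_iff_cobounded]
    refine Real.tendsto_exp_atTop.congr fun t => ?_
    have : ((axis t : ℍ) : ℂ) = (Real.exp t : ℂ) * Complex.I := by
      apply Complex.ext <;> simp [axis, -Complex.ofReal_exp]
    rw [this, norm_mul, Complex.norm_I, mul_one, Complex.norm_real, Real.norm_eq_abs, Real.abs_exp]
  rw [← coclosedCompact_eq_cocompact] at h
  exact OnePoint.tendsto_coe_infty.comp h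

lemma tendsto_axis_atBot :
    Tendsto (fun t => hypToSphere (axis t)) atBot
      (𝓝 (circleToSphere ((0 : ℝ) : OnePoint ℝ))) := by
  have h : Tendsto (fun t => ((axis t : ℍ) : ℂ)) atBot (𝓝 ((0 : ℝ) : ℂ)) := by
    have := ((Complex.continuous_ofReal.tendsto 0).comp Real.tendsto_exp_atBot).mul_const Complex.I
    rw [Complex.ofReal_zero, zero_mul] at this
    rw [Complex.ofReal_zero]
    refine this.congr fun t => ?_
    apply Complex.ext <;> simp [axis, -Complex.ofReal_exp]
  exact (OnePoint.continuous_coe.tendsto _).comp h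

lemma tendsto_smul_axis_atTop (g : SL(2, ℝ)) :
    Tendsto (fun t => hypToSphere (g • axis t)) atTop
      (𝓝 (circleToSphere (moebiusAtInfinity g OnePoint.infty))) :=
  tendsto_axis_atTop.hypToSphere_smul g

lemma tendsto_smul_axis_atBot (g : SL(2, ℝ)) :
    Tendsto (fun t => hypToSphere (g • axis t)) atBot
      (𝓝 (circleToSphere (moebiusAtInfinity g ((0 : ℝ) : OnePoint ℝ)))) :=
  tendsto_axis_atBot.hypToSphere_smul g

/-- The ends of a line are determined by its image. -/
lemma isEndAtInfinity_smul_axis_iff {g : SL(2, ℝ)} {ξ : OnePoint ℝ} :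
    IsEndAtInfinity (fun t => g • axis t) ξ ↔
      ξ = moebiusAtInfinity g OnePoint.infty ∨
        ξ = moebiusAtInfinity g ((0 : ℝ) : OnePoint ℝ) := by
  constructor
  · rintro (h | h)
    · exact .inl (circleToSphere_injective (tendsto_nhds_unique h (tendsto_smul_axis_atTop g)))
    · exact .inr (circleToSphere_injective (tendsto_nhds_unique h (tendsto_smul_axis_atBot g)))
  · rintro (rfl | rfl)
    · exact .inl (tendsto_smul_axis_atTop g)
    · exact .inr (tendsto_smul_axis_atBot g)

/-! ### Perpendicular bisectors -/

/-- A perpendicular bisector that meets `axis` twice is its image. -/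
lemma dist_eq_dist_iff_re_eq_zero {a b : ℍ} (hab : a ≠ b) {s t : ℝ} (hst : s ≠ t)
    (hs : dist (axis s) a = dist (axis s) b) (ht : dist (axis t) a = dist (axis t) b) (w : ℍ) :
    dist w a = dist w b ↔ w.re = 0 := by
  -- Equidistance on the axis is an affine condition on `exp u ^ 2`. Two solutions force `a` and `b`
  -- to have equal height and equal modulus, so they are mirror images in the axis.
  have key : ∀ u, dist (axis u) a = dist (axis u) b →
      Real.exp u ^ 2 * (b.im - a.im) = a.im * (b.re ^ 2 + b.im ^ 2) - b.im * (a.re ^ 2 + a.im ^ 2) := by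
    intro u hu
    have h1 := two_mul_im_mul_cosh_dist_axis a u
    have h2 := two_mul_im_mul_cosh_dist_axis b u
    rw [dist_comm, hu, dist_comm] at h1
    linear_combination a.im * h2 - b.im * h1
  have hne : Real.exp s ^ 2 - Real.exp t ^ 2 ≠ 0 := by
    rw [sub_ne_zero]
    intro h
    exact hst (Real.exp_injective
      ((pow_left_inj₀ (Real.exp_pos s).le (Real.exp_pos t).le two_ne_zero).1 h))
  have him : b.im - a.im = 0 := by
    refine (mul_eq_zero.1 ?_).resolve_left hne
    linear_combination key s hs - key t ht
  have hk := key s hs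
  have him' : b.im = a.im := by linarith
  have ha := a.im_pos
  have hre2 : b.re ^ 2 = a.re ^ 2 := by
    rw [him, mul_zero, him'] at hk
    have := ha.ne'
    have h3 : a.im * (b.re ^ 2 - a.re ^ 2) = 0 := by linear_combination -hk
    have := (mul_eq_zero.1 h3).resolve_left ‹_›
    linarith
  have hre : b.re = -a.re := by
    rcases sq_eq_sq_iff_eq_or_eq_neg.1 hre2 with h | h
    · exact absurd (UpperHalfPlane.ext_re_im h.symm him'.symm) hab
    · exact h
  have hare : a.re ≠ 0 := fun h0 => hab (UpperHalfPlane.ext_re_im (by rw [hre, h0]; simp) him'.symm)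
  have e1 := two_mul_im_mul_im_mul_cosh_dist w a
  have e2 := two_mul_im_mul_im_mul_cosh_dist w b
  rw [him', hre] at e2
  have hw := w.im_pos
  constructor
  · intro h
    rw [h] at e1
    have : a.re * w.re = 0 := by linear_combination (e1 - e2) / 4
    exact (mul_eq_zero.1 this).resolve_left hare
  · intro h
    rw [h] at e1 e2
    have h5 : Real.cosh (dist w a) = Real.cosh (dist w b) := by
      have h6 : 2 * w.im * a.im ≠ 0 := by positivity
      apply mul_left_cancel₀ h6
      linear_combination e1 - e2
    refine le_antisymm ?_ ?_
    · have := Real.cosh_le_cosh.1 h5.le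
      rwa [abs_of_nonneg dist_nonneg, abs_of_nonneg dist_nonneg] at this
    · have := Real.cosh_le_cosh.1 h5.ge
      rwa [abs_of_nonneg dist_nonneg, abs_of_nonneg dist_nonneg] at this

lemma dist_smul_left_eq (g : SL(2, ℝ)) (x y : ℍ) : dist (g • x) y = dist x (g⁻¹ • y) := by
  rw [← dist_smul g x (g⁻¹ • y), smul_inv_smul]

/-- A line meeting a perpendicular bisector twice is contained in it. -/
lemma dist_eq_dist_of_smul_axis {a b : ℍ} (hab : a ≠ b) (g : SL(2, ℝ)) {s t : ℝ} (hst : s ≠ t)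
    (hs : dist (g • axis s) a = dist (g • axis s) b)
    (ht : dist (g • axis t) a = dist (g • axis t) b) (u : ℝ) :
    dist (g • axis u) a = dist (g • axis u) b := by
  simp only [dist_smul_left_eq] at *
  exact (dist_eq_dist_iff_re_eq_zero (fun h => hab (smul_left_cancel _ h)) hst hs ht _).2 (by simp)

/-- Two lines in the same perpendicular bisector differ by a reparametrization. -/
lemma exists_smul_axis_eq_of_bisector {a b : ℍ} (hab : a ≠ b) {g g' : SL(2, ℝ)}
    (hg : ∀ t, dist (g • axis t) a = dist (g • axis t) b)
    (hg' : ∀ t, dist (g' • axis t) a = dist (g' • axis t) b) :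
    ∃ s : ℝ, (∀ t, g' • axis t = g • axis (s + t)) ∨ ∀ t, g' • axis t = g • axis (s - t) := by
  have hre : ∀ t, (g⁻¹ • g' • axis t).re = 0 := by
    intro t
    have h := fun t => hg t
    simp only [dist_smul_left_eq g] at h
    refine (dist_eq_dist_iff_re_eq_zero (fun h => hab (smul_left_cancel _ h)) zero_ne_one
      (h 0) (h 1) _).1 ?_
    rw [dist_smul, dist_smul]
    exact hg' t
  obtain ⟨s, h⟩ := ((isometry_smul ℍ g⁻¹).comp (isometry_smul_axis g')).eq_axis (hre 0) (hre 1)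
  refine ⟨s, h.imp (fun h t => ?_) fun h t => ?_⟩
  · rw [← h t]; simp
  · rw [← h t]; simp

/-! ### Geodesics between ideal points of a convex set -/

/-- In the coordinates `(re z, |z|²)`, hyperbolic segments are affine segments. -/
lemma dist_add_dist_of_affine {x y z : ℍ} {α β : ℝ} (hα : 0 ≤ α) (hβ : 0 ≤ β) (hαβ : α + β = 1)
    (hre : z.re = α * x.re + β * y.re)
    (hsq : z.re ^ 2 + z.im ^ 2 = α * (x.re ^ 2 + x.im ^ 2) + β * (y.re ^ 2 + y.im ^ 2)) :
    dist x z + dist z y = dist x y := by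
  have hx := x.im_pos
  have hy := y.im_pos
  have hz := z.im_pos
  have lin : ∀ w : ℍ, z.im * Real.cosh (dist w z) =
      α * x.im * Real.cosh (dist w x) + β * y.im * Real.cosh (dist w y) := by
    intro w
    have e1 := two_mul_im_mul_im_mul_cosh_dist w z
    have e2 := two_mul_im_mul_im_mul_cosh_dist w x
    have e3 := two_mul_im_mul_im_mul_cosh_dist w y
    have hw : 2 * w.im ≠ 0 := by have := w.im_pos; positivity
    apply mul_left_cancel₀ hw
    linear_combination e1 - α * e2 - β * e3 + hsq - 2 * w.re * hre
      - (w.re ^ 2 + w.im ^ 2) * hαβ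
  -- In the hyperboloid model this says `z = a x + b y`, and `h3` below says that `z` has unit
  -- Lorentz norm. The hyperbolic sines of the two partial distances follow, and the addition
  -- formula for `cosh` finishes.
  set a := α * x.im / z.im with ha
  set b := β * y.im / z.im with hb
  have ha0 : 0 ≤ a := by positivity
  have hb0 : 0 ≤ b := by positivity
  have lin' : ∀ w : ℍ, Real.cosh (dist w z) =
      a * Real.cosh (dist w x) + b * Real.cosh (dist w y) := by
    intro w
    rw [ha, hb]
    field_simp
    linarith [lin w]
  set C := Real.cosh (dist x y) with hC
  have h1 : Real.cosh (dist x z) = a + b * C := by simpa using lin' x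
  have h2 : Real.cosh (dist z y) = a * C + b := by
    rw [dist_comm, lin' y, dist_comm y x]; simp [hC]
  have h3 : a ^ 2 + b ^ 2 + 2 * a * b * C = 1 := by
    have := lin' z
    rw [dist_self, Real.cosh_zero, dist_comm z x, h1, h2] at this
    linear_combination -this
  have hS : Real.sinh (dist x y) ^ 2 = C ^ 2 - 1 := Real.sinh_sq _
  have s1 : Real.sinh (dist x z) = b * Real.sinh (dist x y) := by
    refine (pow_left_inj₀ (Real.sinh_nonneg_iff.2 dist_nonneg)
      (mul_nonneg hb0 (Real.sinh_nonneg_iff.2 dist_nonneg)) two_ne_zero).1 ?_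
    rw [Real.sinh_sq, h1, mul_pow, hS]
    linear_combination h3
  have s2 : Real.sinh (dist z y) = a * Real.sinh (dist x y) := by
    refine (pow_left_inj₀ (Real.sinh_nonneg_iff.2 dist_nonneg)
      (mul_nonneg ha0 (Real.sinh_nonneg_iff.2 dist_nonneg)) two_ne_zero).1 ?_
    rw [Real.sinh_sq, h2, mul_pow, hS]
    linear_combination h3
  have hsum : Real.cosh (dist x z + dist z y) = Real.cosh (dist x y) := by
    rw [Real.cosh_add, h1, h2, s1, s2]
    linear_combination a * b * hS + C * h3
  have hnn : 0 ≤ dist x z + dist z y := by positivity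
  have key := fun {u v : ℝ} (hu : 0 ≤ u) (hv : 0 ≤ v) (h : Real.cosh u ≤ Real.cosh v) =>
    (show u ≤ v by have := Real.cosh_le_cosh.1 h; rwa [abs_of_nonneg hu, abs_of_nonneg hv] at this)
  exact le_antisymm (key hnn dist_nonneg hsum.le) (key dist_nonneg hnn hsum.ge)

lemma exists_affine_point (x y : ℍ) {β : ℝ} (hβ : 0 ≤ β) (hβ1 : β ≤ 1) :
    ∃ z : ℍ, z.re = (1 - β) * x.re + β * y.re ∧
      z.re ^ 2 + z.im ^ 2 = (1 - β) * (x.re ^ 2 + x.im ^ 2) + β * (y.re ^ 2 + y.im ^ 2) := by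
  have hpos : 0 < (1 - β) * (x.re ^ 2 + x.im ^ 2) + β * (y.re ^ 2 + y.im ^ 2)
      - ((1 - β) * x.re + β * y.re) ^ 2 := by
    have h1 : 0 ≤ (1 - β) * β * (x.re - y.re) ^ 2 :=
      mul_nonneg (mul_nonneg (by linarith) hβ) (sq_nonneg _)
    have hx : 0 < x.im ^ 2 := by have := x.im_pos; positivity
    have hy : 0 < y.im ^ 2 := by have := y.im_pos; positivity
    have h2 : 0 < (1 - β) * x.im ^ 2 + β * y.im ^ 2 := by
      rcases hβ.eq_or_lt with h | h
      · simpa [← h] using hx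
      · have := mul_pos h hy
        have := mul_nonneg (sub_nonneg.2 hβ1) hx.le
        linarith
    linarith
  refine ⟨⟨⟨(1 - β) * x.re + β * y.re, √((1 - β) * (x.re ^ 2 + x.im ^ 2)
    + β * (y.re ^ 2 + y.im ^ 2) - ((1 - β) * x.re + β * y.re) ^ 2)⟩, Real.sqrt_pos.2 hpos⟩,
    rfl, ?_⟩
  simp only [UpperHalfPlane.mk_re, UpperHalfPlane.mk_im]
  rw [Real.sq_sqrt hpos.le]
  ring

/-- Geodesic convexity. -/
def GeodesicallyConvex (C : Set ℍ) : Prop :=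
  ∀ x ∈ C, ∀ y ∈ C, ∀ z : ℍ, dist x z + dist z y = dist x y → z ∈ C

lemma UpperHalfPlane.tendsto_of_re_of_sq {z : ℕ → ℍ} {w : ℍ}
    (hre : Tendsto (fun n => (z n).re) atTop (𝓝 w.re))
    (hsq : Tendsto (fun n => (z n).re ^ 2 + (z n).im ^ 2) atTop (𝓝 (w.re ^ 2 + w.im ^ 2))) :
    Tendsto z atTop (𝓝 w) := by
  have him : Tendsto (fun n => (z n).im) atTop (𝓝 w.im) := by
    have h1 := (hsq.sub (hre.pow 2)).sqrt
    rw [add_sub_cancel_left, Real.sqrt_sq w.im_pos.le] at h1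
    refine h1.congr fun n => ?_
    rw [add_sub_cancel_left, Real.sqrt_sq (z n).im_pos.le]
  rw [UpperHalfPlane.isEmbedding_coe.tendsto_nhds_iff]
  have h2 : Tendsto (fun n => ((z n).re : ℂ) + (z n).im * Complex.I) atTop
      (𝓝 ((w.re : ℂ) + w.im * Complex.I)) :=
    ((Complex.continuous_ofReal.tendsto _).comp hre).add
      (((Complex.continuous_ofReal.tendsto _).comp him).mul_const _)
  simpa [UpperHalfPlane.re_add_im, Function.comp_def] using h2

lemma UpperHalfPlane.norm_coe_sq (z : ℍ) : ‖(z : ℂ)‖ ^ 2 = z.re ^ 2 + z.im ^ 2 := by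
  rw [Complex.sq_norm, Complex.normSq_apply]
  simp [sq]

lemma exists_norm_lt_of_zero_mem_closure {C : Set ℍ}
    (h : circleToSphere ((0 : ℝ) : OnePoint ℝ) ∈ closure (hypToSphere '' C)) {ε : ℝ} (hε : 0 < ε) :
    ∃ x ∈ C, ‖(x : ℂ)‖ < ε := by
  have ho : IsOpen (((↑) : ℂ → OnePoint ℂ) '' Metric.ball 0 ε) :=
    OnePoint.isOpenEmbedding_coe.isOpenMap _ Metric.isOpen_ball
  obtain ⟨_, ⟨u, hu, hu'⟩, x, hx, rfl⟩ := mem_closure_iff.1 h _ ho ⟨0, by simpa using hε, rfl⟩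
  refine ⟨x, hx, ?_⟩
  rw [← OnePoint.coe_injective hu']
  simpa using hu

lemma exists_lt_norm_of_infty_mem_closure {C : Set ℍ}
    (h : circleToSphere OnePoint.infty ∈ closure (hypToSphere '' C)) (R : ℝ) :
    ∃ x ∈ C, R < ‖(x : ℂ)‖ := by
  have ho : IsOpen (((↑) : ℂ → OnePoint ℂ) '' Metric.closedBall 0 R)ᶜ :=
    OnePoint.isOpen_compl_image_coe.2 ⟨Metric.isClosed_closedBall, isCompact_closedBall _ _⟩
  obtain ⟨_, hu, x, hx, rfl⟩ := mem_closure_iff.1 h _ ho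
    (by rintro ⟨u, -, hu⟩; exact OnePoint.coe_ne_infty u hu)
  refine ⟨x, hx, ?_⟩
  by_contra hle
  exact hu ⟨x, by simpa using hle, rfl⟩

/-- Segments join points of `C` near `0` to points of `C` near `∞`; suitable points on them converge
to the given point of the axis, and `C` is closed. -/
lemma GeodesicallyConvex.axis_mem {C : Set ℍ} (hC : GeodesicallyConvex C) (hcl : IsClosed C)
    (h0 : circleToSphere ((0 : ℝ) : OnePoint ℝ) ∈ closure (hypToSphere '' C))
    (h1 : circleToSphere OnePoint.infty ∈ closure (hypToSphere '' C)) (t : ℝ) : axis t ∈ C := by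
  set r := Real.exp t with hr
  have hr0 : 0 < r := Real.exp_pos t
  choose x hxC hx using fun n : ℕ =>
    exists_norm_lt_of_zero_mem_closure h0 (Nat.one_div_pos_of_nat (α := ℝ) (n := n))
  choose y hyC hy using fun n : ℕ => exists_lt_norm_of_infty_mem_closure h1 (n + r)
  have hy0 : ∀ n, r < ‖(y n : ℂ)‖ := fun n =>
    lt_of_le_of_lt (by simp) (hy n)
  have hβ1 : ∀ n, r ^ 2 / ‖(y n : ℂ)‖ ^ 2 ≤ 1 := fun n =>
    div_le_one_of_le₀ (pow_le_pow_left₀ hr0.le (hy0 n).le 2) (by positivity)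
  -- The weight `r² / |y n|²` is chosen so that the far endpoint contributes exactly `r²` to `|z
  -- n|²`, but only `O(1 / |y n|)` to the real part.
  choose z hzre hzsq using fun n => exists_affine_point (x n) (y n)
    (β := r ^ 2 / ‖(y n : ℂ)‖ ^ 2) (by positivity) (hβ1 n)
  have hzC : ∀ n, z n ∈ C := fun n => hC _ (hxC n) _ (hyC n) _
    (dist_add_dist_of_affine (sub_nonneg.2 (hβ1 n)) (by positivity) (by ring) (hzre n) (hzsq n))
  have hxlim : Tendsto (fun n => ‖(x n : ℂ)‖) atTop (𝓝 0) :=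
    squeeze_zero (fun _ => norm_nonneg _) (fun n => (hx n).le) tendsto_one_div_add_atTop_nhds_zero_nat
  have hylim : Tendsto (fun n => ‖(y n : ℂ)‖⁻¹) atTop (𝓝 0) := by
    refine tendsto_inv_atTop_zero.comp (tendsto_atTop_mono (fun n => ?_)
      tendsto_natCast_atTop_atTop)
    have := hy n
    linarith
  refine hcl.mem_of_tendsto (UpperHalfPlane.tendsto_of_re_of_sq (z := z) ?_ ?_)
    (Eventually.of_forall hzC)
  · rw [axis_re]
    have hb : Tendsto (fun n => ‖(x n : ℂ)‖ + r ^ 2 * ‖(y n : ℂ)‖⁻¹) atTop (𝓝 0) := by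
      simpa using hxlim.add (hylim.const_mul (r ^ 2))
    refine squeeze_zero_norm (fun n => ?_) hb
    rw [hzre n]
    refine (norm_add_le _ _).trans (add_le_add ?_ ?_)
    · rw [norm_mul, Real.norm_eq_abs, Real.norm_eq_abs, abs_of_nonneg (sub_nonneg.2 (hβ1 n))]
      have h2 : |(x n).re| ≤ ‖(x n : ℂ)‖ := Complex.abs_re_le_norm _
      have h3 : 0 ≤ r ^ 2 / ‖(y n : ℂ)‖ ^ 2 := by positivity
      nlinarith [abs_nonneg (x n).re]
    · rw [norm_mul, Real.norm_eq_abs, Real.norm_eq_abs, abs_of_nonneg (by positivity)]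
      have h2 : |(y n).re| ≤ ‖(y n : ℂ)‖ := Complex.abs_re_le_norm _
      have h4 : 0 < ‖(y n : ℂ)‖ := hr0.trans (hy0 n)
      calc r ^ 2 / ‖(y n : ℂ)‖ ^ 2 * |(y n).re| ≤ r ^ 2 / ‖(y n : ℂ)‖ ^ 2 * ‖(y n : ℂ)‖ := by
            gcongr
        _ = r ^ 2 * ‖(y n : ℂ)‖⁻¹ := by field_simp
  · have e : ∀ n, (z n).re ^ 2 + (z n).im ^ 2 =
        (1 - r ^ 2 * (‖(y n : ℂ)‖⁻¹) ^ 2) * ‖(x n : ℂ)‖ ^ 2 + r ^ 2 := by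
      intro n
      have h4 : ‖(y n : ℂ)‖ ≠ 0 := (hr0.trans (hy0 n)).ne'
      rw [hzsq n, ← UpperHalfPlane.norm_coe_sq, ← UpperHalfPlane.norm_coe_sq]
      field_simp
    simp only [e]
    have := ((((hylim.pow 2).const_mul (r ^ 2)).const_sub 1).mul (hxlim.pow 2)).add_const (r ^ 2)
    simpa using this

lemma circleToSphere_smul_mem_closure {C D : Set ℍ} (g : SL(2, ℝ)) (hCD : ∀ z ∈ C, g • z ∈ D)
    {ξ : OnePoint ℝ} (h : circleToSphere ξ ∈ closure (hypToSphere '' C)) :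
    circleToSphere (moebiusAtInfinity g ξ) ∈ closure (hypToSphere '' D) := by
  rw [circleToSphere_smul]
  refine map_mem_closure (continuous_gl_smul_onePoint (complexify g)) h ?_
  rintro _ ⟨z, hz, rfl⟩
  exact ⟨g • z, hCD z hz, hypToSphere_smul g z⟩

/-- A closed convex set contains the geodesics between its points at infinity. -/
lemma GeodesicallyConvex.smul_axis_mem {C : Set ℍ} (hC : GeodesicallyConvex C) (hcl : IsClosed C)
    {g : SL(2, ℝ)}
    (h0 : circleToSphere (moebiusAtInfinity g ((0 : ℝ) : OnePoint ℝ)) ∈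
      closure (hypToSphere '' C))
    (h1 : circleToSphere (moebiusAtInfinity g OnePoint.infty) ∈ closure (hypToSphere '' C))
    (t : ℝ) : g • axis t ∈ C := by
  have hD : GeodesicallyConvex {z | g • z ∈ C} := fun x hx y hy z hz =>
    hC _ hx _ hy _ (by simpa only [dist_smul] using hz)
  refine hD.axis_mem (hcl.preimage (continuous_const_smul g)) ?_ ?_ t
  · simpa using circleToSphere_smul_mem_closure (D := {z | g • z ∈ C}) g⁻¹ (by simp) h0
  · simpa using circleToSphere_smul_mem_closure (D := {z | g • z ∈ C}) g⁻¹ (by simp) h1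

/-! ### Lines in the frontier of the universal cover -/

lemma moebiusAtInfinity_axisFlip_infty :
    moebiusAtInfinity axisFlip OnePoint.infty = ((0 : ℝ) : OnePoint ℝ) := by
  simp [moebiusAtInfinity_infty, axisFlip]

/-- A transformation translating `axis` acts on the ideal boundary as a homothety. -/
lemma moebiusAtInfinity_of_smul_axis {D : SL(2, ℝ)} {T : ℝ}
    (h : ∀ t, D • axis t = axis (T + t)) :
    moebiusAtInfinity D OnePoint.infty = OnePoint.infty ∧
      ∀ x : ℝ, moebiusAtInfinity D (x : OnePoint ℝ) = ((Real.exp T * x : ℝ) : OnePoint ℝ) := by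
  -- Real and imaginary parts of `D • axis t = axis (T + t)` with the denominator cleared. Comparing
  -- `t = 0` with `t = 1` makes the off-diagonal entries vanish.
  have key : ∀ t, D 0 1 = -(Real.exp T * D 1 0 * Real.exp t ^ 2) ∧
      D 0 0 = Real.exp T * D 1 1 := by
    intro t
    have h1 := congrArg UpperHalfPlane.coe (h t)
    have hden : (D 1 0 : ℂ) * (axis t : ℂ) + D 1 1 ≠ 0 :=
      UpperHalfPlane.denom_ne_zero (D : GL (Fin 2) ℝ) (axis t)
    simp only [UpperHalfPlane.coe_specialLinearGroup_apply, Algebra.algebraMap_self_apply] at h1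
    rw [div_eq_iff hden] at h1
    have hre := congrArg Complex.re h1
    have him := congrArg Complex.im h1
    simp [axis, Real.exp_add, -Complex.ofReal_exp] at hre him
    have := (Real.exp_pos t).ne'
    constructor
    · linear_combination hre
    · apply mul_right_cancel₀ this
      linear_combination him
  have hT := (Real.exp_pos T).ne'
  have hc : D 1 0 = 0 := by
    have h0 := (key 0).1
    have h1 := (key 1).1
    have hne : Real.exp T * (Real.exp 1 ^ 2 - 1) ≠ 0 := by
      have : (1 : ℝ) < Real.exp 1 := by simp
      have : 0 < Real.exp 1 ^ 2 - 1 := by nlinarith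
      positivity
    apply (mul_eq_zero.1 (_ : (Real.exp T * (Real.exp 1 ^ 2 - 1)) * D 1 0 = 0)).resolve_left hne
    rw [Real.exp_zero] at h0
    linear_combination h1 - h0
  have hb : D 0 1 = 0 := by rw [(key 0).1, hc]; ring
  have ha := (key 0).2
  have hdet : D 0 0 * D 1 1 - D 0 1 * D 1 0 = 1 := by
    have := D.det_coe
    rwa [Matrix.det_fin_two] at this
  have hd : D 1 1 ≠ 0 := by
    intro h0
    rw [h0, hc] at hdet
    norm_num at hdet
  refine ⟨by simp [moebiusAtInfinity_infty, hc], fun x => ?_⟩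
  rw [moebiusAtInfinity_coe, hc, hb, ha, zero_mul, zero_add, if_neg hd]
  congr 1
  field_simp
  ring

namespace HyperbolicMetric

variable {S : Type*} [TopologicalSpace S] (h : HyperbolicMetric S)

lemma smul_mem_cover_iff {γ : SL(2, ℝ)} (hγ : γ ∈ h.deck) {z : ℍ} :
    γ • z ∈ h.cover ↔ z ∈ h.cover :=
  ⟨fun hz => by simpa using h.smul_mem_cover γ⁻¹ (inv_mem hγ) _ hz, h.smul_mem_cover γ hγ z⟩

lemma frontier_subset : frontier h.cover ⊆ h.cover := h.isClosed_cover.frontier_subset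

lemma smul_mem_frontier {γ : SL(2, ℝ)} (hγ : γ ∈ h.deck) {z : ℍ} (hz : z ∈ frontier h.cover) :
    γ • z ∈ frontier h.cover := by
  have h1 : (fun w : ℍ => γ • w) ⁻¹' h.cover = h.cover := by
    ext w
    exact h.smul_mem_cover_iff hγ
  have h2 := (Homeomorph.smul γ : ℍ ≃ₜ ℍ).preimage_frontier h.cover
  change z ∈ (fun w : ℍ => γ • w) ⁻¹' frontier h.cover
  have h3 : (fun w : ℍ => γ • w) ⁻¹' frontier h.cover
      = frontier ((fun w : ℍ => γ • w) ⁻¹' h.cover) := h2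
  rwa [h3, h1]

/-- In the local half-plane model, a point with strict inequality has a whole neighbourhood in the
cover, so frontier points must lie on the bounding geodesic. -/
lemma exists_bisector {x : ℍ} (hx : x ∈ frontier h.cover) :
    ∃ a b : ℍ, a ≠ b ∧ ∃ U : Set ℍ, IsOpen U ∧ x ∈ U ∧
      ∀ z ∈ U, z ∈ frontier h.cover → dist z a = dist z b := by
  rcases h.geodesic_boundary x (h.frontier_subset hx) with hi | ⟨a, b, hab, -, hev⟩
  · exact absurd hi hx.2
  obtain ⟨U, hU, hUo, hxU⟩ := eventually_nhds_iff.1 hev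
  refine ⟨a, b, hab, U, hUo, hxU, fun z hz hzf => ?_⟩
  refine le_antisymm ((hU z hz).1 (h.frontier_subset hzf)) ?_
  by_contra! hlt
  apply hzf.2
  rw [mem_interior_iff_mem_nhds]
  have h1 : ∀ᶠ w in 𝓝 z, dist w a < dist w b :=
    (isOpen_lt (continuous_id.dist continuous_const) (continuous_id.dist continuous_const)).mem_nhds
      hlt
  filter_upwards [h1, hUo.mem_nhds hz] with w hw hwU
  exact (hU w hwU).2 hw.le

/-- The Moebius transformations that move `axis` into the frontier of the universal cover. -/
def frontierLines : Set SL(2, ℝ) := {g | ∀ t, g • axis t ∈ frontier h.cover}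

variable {h}

lemma mul_mem_frontierLines {γ g : SL(2, ℝ)} (hγ : γ ∈ h.deck) (hg : g ∈ h.frontierLines) :
    γ * g ∈ h.frontierLines := fun t => by
  rw [mul_smul]; exact h.smul_mem_frontier hγ (hg t)

lemma mul_axisFlip_mem_frontierLines {g : SL(2, ℝ)} (hg : g ∈ h.frontierLines) :
    g * axisFlip ∈ h.frontierLines := fun t => by
  rw [mul_smul, axisFlip_smul]; exact hg _

/-- A frontier line that enters `U` stays there for nearby parameters, so it meets the bisector at
least twice and hence is contained in it. -/
lemma dist_eq_dist_of_mem_frontierLines {a b : ℍ} (hab : a ≠ b) {U : Set ℍ} (hU : IsOpen U)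
    (hUab : ∀ z ∈ U, z ∈ frontier h.cover → dist z a = dist z b) {g : SL(2, ℝ)}
    (hg : g ∈ h.frontierLines) {t : ℝ} (ht : g • axis t ∈ U) (u : ℝ) :
    dist (g • axis u) a = dist (g • axis u) b := by
  have hev : ∀ᶠ s in 𝓝 t, g • axis s ∈ U :=
    (isometry_smul_axis g).continuous.continuousAt.eventually_mem (hU.mem_nhds ht)
  obtain ⟨s, hs, hst⟩ := ((hev.filter_mono nhdsWithin_le_nhds).and
    (self_mem_nhdsWithin (a := t) (s := {t}ᶜ))).exists
  exact dist_eq_dist_of_smul_axis hab g (s := s) (t := t) hst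
    (hUab _ hs (hg s)) (hUab _ ht (hg t)) u

variable (h) in
/-- The endpoints of the lines in the frontier of the universal cover. -/
def frontierEnds : Set (OnePoint ℝ) :=
  (fun g => moebiusAtInfinity g OnePoint.infty) '' h.frontierLines

lemma moebiusAtInfinity_mem_frontierEnds {γ : SL(2, ℝ)} (hγ : γ ∈ h.deck) {ξ : OnePoint ℝ}
    (hξ : ξ ∈ h.frontierEnds) : moebiusAtInfinity γ ξ ∈ h.frontierEnds := by
  obtain ⟨g, hg, rfl⟩ := hξ
  exact ⟨γ * g, mul_mem_frontierLines hγ hg, moebiusAtInfinity_mul _ _ _⟩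

lemma mem_frontierEnds_of_isEndAtInfinity {σ : ℝ → ℍ} (hσ : Isometry σ)
    (hf : ∀ t, σ t ∈ frontier h.cover) {ξ : OnePoint ℝ} (hξ : IsEndAtInfinity σ ξ) :
    ξ ∈ h.frontierEnds := by
  obtain ⟨g, hg⟩ := hσ.exists_eq_smul_axis
  obtain rfl : σ = fun t => g • axis t := funext hg
  rcases isEndAtInfinity_smul_axis_iff.1 hξ with rfl | rfl
  · exact ⟨g, hf, rfl⟩
  · refine ⟨g * axisFlip, mul_axisFlip_mem_frontierLines hf, ?_⟩
    simp only [moebiusAtInfinity_mul, moebiusAtInfinity_axisFlip_infty]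

/-- By the Lindelöf property countably many of the neighbourhoods `U x` cover the frontier. All
frontier lines based in one of them lie on the same bisector, so they contribute at most two ends.
-/
lemma countable_frontierEnds : h.frontierEnds.Countable := by
  choose! a b hab U hUo hxU hU using fun x (hx : x ∈ frontier h.cover) => h.exists_bisector hx
  obtain ⟨c, hcF, hcc, hcU⟩ := TopologicalSpace.countable_cover_nhdsWithin
    (s := frontier h.cover) (f := U)
    fun x hx => mem_nhdsWithin_of_mem_nhds ((hUo x hx).mem_nhds (hxU x hx))
  have hsub : h.frontierEnds ⊆ ⋃ x ∈ c, (fun g => moebiusAtInfinity g OnePoint.infty) ''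
      {g ∈ h.frontierLines | g • axis 0 ∈ U x} := by
    rintro _ ⟨g, hg, rfl⟩
    obtain ⟨x, hx, hgx⟩ := Set.mem_iUnion₂.1 (hcU (hg 0))
    exact Set.mem_iUnion₂.2 ⟨x, hx, g, ⟨hg, hgx⟩, rfl⟩
  refine Set.Countable.mono hsub (hcc.biUnion fun x hx => ?_)
  have hxF := hcF hx
  rcases Set.eq_empty_or_nonempty {g ∈ h.frontierLines | g • axis 0 ∈ U x} with he | ⟨g, hg, hgU⟩
  · rw [he]; simp
  refine Set.Countable.mono (s₂ := {moebiusAtInfinity g OnePoint.infty,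
    moebiusAtInfinity g ((0 : ℝ) : OnePoint ℝ)}) ?_ ((Set.countable_singleton _).insert _)
  rintro _ ⟨g', ⟨hg', hgU'⟩, rfl⟩
  obtain ⟨s, hs⟩ := exists_smul_axis_eq_of_bisector (hab x hxF)
    (dist_eq_dist_of_mem_frontierLines (hab x hxF) (hUo x hxF) (hU x hxF) hg hgU)
    (dist_eq_dist_of_mem_frontierLines (hab x hxF) (hUo x hxF) (hU x hxF) hg' hgU')
  have hlim := tendsto_smul_axis_atTop g'
  rcases hs with hs | hs <;> simp only [hs] at hlim
  · left
    exact circleToSphere_injective (tendsto_nhds_unique hlim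
      ((tendsto_smul_axis_atTop g).comp (tendsto_atTop_add_const_left _ s tendsto_id)))
  · right
    exact circleToSphere_injective (tendsto_nhds_unique hlim
      ((tendsto_smul_axis_atBot g).comp
        (tendsto_atBot_add_const_left _ s tendsto_neg_atTop_atBot)))

/-- Compactness: each line in the frontier of the universal cover is translated along itself by
a deck transformation. -/
lemma exists_deck_translation [CompactSpace S] {g : SL(2, ℝ)} (hg : g ∈ h.frontierLines) :
    ∃ δ ∈ h.deck, ∃ T ≠ 0, ∀ t, δ • g • axis t = g • axis (T + t) := by
  have hgc : ∀ t, g • axis t ∈ h.cover := fun t => h.frontier_subset (hg t)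
  -- The sample points are spaced by `3` because two points in a ball of radius `1` are less than
  -- `2` apart. Two returns to such a ball thus cannot come from a trivial translation.
  obtain ⟨s, -, hs⟩ := isCompact_univ (X := S).exists_mapClusterPt (f := atTop)
    (u := fun n : ℕ => h.proj ⟨g • axis (3 * n), hgc _⟩) (by simp)
  obtain ⟨x, rfl⟩ := h.surjective_proj s
  have hfreq : ∀ V : Set ℍ, IsOpen V → (x : ℍ) ∈ V →
      ∃ᶠ n : ℕ in atTop, ∃ γ ∈ h.deck, γ • g • axis (3 * n) ∈ V := by
    intro V hV hxV
    have h1 : h.proj '' (Subtype.val ⁻¹' V) ∈ 𝓝 (h.proj x) :=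
      h.isCoveringMap_proj.isLocalHomeomorph.isOpenMap.image_mem_nhds
        ((hV.preimage continuous_subtype_val).mem_nhds hxV)
    refine (hs.frequently h1).mono fun n hn => ?_
    obtain ⟨y, hy, hyn⟩ := hn
    obtain ⟨γ, hγ, hγy⟩ := (h.proj_eq_iff _ _).1 hyn.symm
    exact ⟨γ, hγ, by rw [hγy]; exact hy⟩
  have hxF : (x : ℍ) ∈ frontier h.cover := by
    rw [← isClosed_frontier.closure_eq, mem_closure_iff]
    intro V hV hxV
    obtain ⟨n, γ, hγ, hn⟩ := (hfreq V hV hxV).exists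
    exact ⟨_, hn, h.smul_mem_frontier hγ (hg _)⟩
  obtain ⟨a, b, hab, U, hUo, hxU, hU⟩ := h.exists_bisector hxF
  have hinf := Nat.frequently_atTop_iff_infinite.1
    (hfreq (U ∩ Metric.ball (x : ℍ) 1) (hUo.inter Metric.isOpen_ball) ⟨hxU, by simp⟩)
  have hclose : ∀ n m : ℕ, n ≠ m → ∀ γ ∈ h.deck, ∀ γ' ∈ h.deck,
      γ • g • axis (3 * n) ∈ U ∩ Metric.ball (x : ℍ) 1 →
      γ' • g • axis (3 * m) ∈ U ∩ Metric.ball (x : ℍ) 1 →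
      (∃ s : ℝ, ∀ t, γ' • g • axis t = γ • g • axis (s + t)) →
      ∃ δ ∈ h.deck, ∃ T ≠ 0, ∀ t, δ • g • axis t = g • axis (T + t) := by
    rintro n m hnm γ hγ γ' hγ' hn hm ⟨s, hs⟩
    refine ⟨γ⁻¹ * γ', mul_mem (inv_mem hγ) hγ', s, ?_, fun t => ?_⟩
    · rintro rfl
      have h1 : dist (γ • g • axis (3 * n)) (γ • g • axis (3 * m)) < 1 + 1 := by
        refine (dist_triangle_right _ _ (x : ℍ)).trans_lt (add_lt_add hn.2 ?_)
        have := hm.2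
        rwa [hs, zero_add] at this
      rw [dist_smul, dist_smul, isometry_axis.dist_eq, Real.dist_eq, ← mul_sub, abs_mul] at h1
      have h2 : (1 : ℝ) ≤ |(n : ℝ) - m| := by
        have : (1 : ℤ) ≤ |(n : ℤ) - m| := Int.one_le_abs (sub_ne_zero.2 (by exact_mod_cast hnm))
        exact_mod_cast this
      norm_num at h1
      linarith
    · rw [mul_smul, hs, inv_smul_smul]
  have hrel : ∀ n m : ℕ, ∀ γ ∈ h.deck, ∀ γ' ∈ h.deck,
      γ • g • axis (3 * n) ∈ U ∩ Metric.ball (x : ℍ) 1 →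
      γ' • g • axis (3 * m) ∈ U ∩ Metric.ball (x : ℍ) 1 →
      ∃ s : ℝ, (∀ t, γ' • g • axis t = γ • g • axis (s + t)) ∨
        ∀ t, γ' • g • axis t = γ • g • axis (s - t) := by
    intro n m γ hγ γ' hγ' hn hm
    simp only [← mul_smul] at hn hm ⊢
    exact exists_smul_axis_eq_of_bisector hab
      (dist_eq_dist_of_mem_frontierLines hab hUo hU (mul_mem_frontierLines hγ hg) hn.1)
      (dist_eq_dist_of_mem_frontierLines hab hUo hU (mul_mem_frontierLines hγ' hg) hm.1)
  -- Three returns are needed: two translates may run along the common bisector in opposite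
  -- directions, but among three some two agree in direction.
  obtain ⟨n₀, γ₀, hγ₀, h₀⟩ := hinf.nonempty
  obtain ⟨n₁, ⟨γ₁, hγ₁, h₁⟩, hlt₁⟩ := hinf.exists_gt n₀
  obtain ⟨n₂, ⟨γ₂, hγ₂, h₂⟩, hlt₂⟩ := hinf.exists_gt n₁
  obtain ⟨s₁, hs₁ | hs₁⟩ := hrel _ _ _ hγ₀ _ hγ₁ h₀ h₁
  · exact hclose n₀ n₁ hlt₁.ne _ hγ₀ _ hγ₁ h₀ h₁ ⟨s₁, hs₁⟩
  obtain ⟨s₂, hs₂ | hs₂⟩ := hrel _ _ _ hγ₀ _ hγ₂ h₀ h₂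
  · exact hclose n₀ n₂ (hlt₁.trans hlt₂).ne _ hγ₀ _ hγ₂ h₀ h₂ ⟨s₂, hs₂⟩
  · refine hclose n₁ n₂ hlt₂.ne _ hγ₁ _ hγ₂ h₁ h₂ ⟨s₁ - s₂, fun t => ?_⟩
    rw [hs₂, hs₁]
    congr 3
    ring

/-- The deck translation along a frontier line acts on the ideal boundary as a homothety. -/
lemma exists_deck_homothety [CompactSpace S] {g : SL(2, ℝ)} (hg : g ∈ h.frontierLines) :
    ∃ δ ∈ h.deck, ∃ c : ℝ, 0 < c ∧ c < 1 ∧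
      moebiusAtInfinity δ (moebiusAtInfinity g OnePoint.infty) =
        moebiusAtInfinity g OnePoint.infty ∧
      ∀ x : ℝ, moebiusAtInfinity δ (moebiusAtInfinity g (x : OnePoint ℝ)) =
        moebiusAtInfinity g ((c * x : ℝ) : OnePoint ℝ) := by
  have main : ∀ δ ∈ h.deck, ∀ T < 0, (∀ t, δ • g • axis t = g • axis (T + t)) →
      ∃ δ ∈ h.deck, ∃ c : ℝ, 0 < c ∧ c < 1 ∧
      moebiusAtInfinity δ (moebiusAtInfinity g OnePoint.infty) =
        moebiusAtInfinity g OnePoint.infty ∧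
      ∀ x : ℝ, moebiusAtInfinity δ (moebiusAtInfinity g (x : OnePoint ℝ)) =
        moebiusAtInfinity g ((c * x : ℝ) : OnePoint ℝ) := by
    intro δ hδ T hT ht
    obtain ⟨h1, h2⟩ := moebiusAtInfinity_of_smul_axis (D := g⁻¹ * δ * g) (T := T) fun t => by
      rw [mul_smul, mul_smul, ht, inv_smul_smul]
    have e : δ * g = g * (g⁻¹ * δ * g) := by group
    refine ⟨δ, hδ, Real.exp T, Real.exp_pos T, by simpa using hT, ?_, fun x => ?_⟩
    · rw [← moebiusAtInfinity_mul, e, moebiusAtInfinity_mul, h1]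
    · rw [← moebiusAtInfinity_mul, e, moebiusAtInfinity_mul, h2]
  obtain ⟨δ, hδ, T, hT, ht⟩ := exists_deck_translation hg
  -- Passing to the inverse if necessary turns the homothety into a contraction.
  rcases hT.lt_or_gt with hT | hT
  · exact main δ hδ T hT ht
  · refine main δ⁻¹ (inv_mem hδ) (-T) (by linarith) fun t => ?_
    rw [inv_smul_eq_iff, ht]
    congr 2
    ring

end HyperbolicMetric

/-! ### The space of geodesics -/

instance : SecondCountableTopology (OnePoint ℝ) :=
  (onePointEquivSphereOfFinrankEq (ι := Fin 2) (V := ℝ) (by simp)).secondCountableTopology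

/-- The quotient topology on unordered pairs. -/
abbrev sym2Topology (X : Type*) [TopologicalSpace X] : TopologicalSpace (Sym2 X) :=
  TopologicalSpace.coinduced (fun q : X × X => s(q.1, q.2)) inferInstance

lemma isClosed_sym2_pencil {X : Type*} [TopologicalSpace X] [T1Space X] (e : X) {K : Set X}
    (hK : IsClosed K) : IsClosed[sym2Topology X] {q : Sym2 X | ∃ y ∈ K, q = s(e, y)} := by
  rw [isClosed_coinduced]
  have : (fun q : X × X => s(q.1, q.2)) ⁻¹' {q : Sym2 X | ∃ y ∈ K, q = s(e, y)}
      = {e} ×ˢ K ∪ K ×ˢ {e} := by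
    ext ⟨u, v⟩
    simp only [Set.mem_preimage, Set.mem_ofPred_eq, Sym2.eq_iff, Set.mem_union, Set.mem_prod,
      Set.mem_singleton_iff]
    constructor
    · rintro ⟨y, hy, ⟨rfl, rfl⟩ | ⟨rfl, rfl⟩⟩
      · exact .inl ⟨rfl, hy⟩
      · exact .inr ⟨hy, rfl⟩
    · rintro (⟨rfl, hv⟩ | ⟨hu, rfl⟩)
      · exact ⟨v, hv, .inl ⟨rfl, rfl⟩⟩
      · exact ⟨u, hu, .inr ⟨rfl, rfl⟩⟩
  rw [this]
  exact (isClosed_singleton.prod hK).union (hK.prod isClosed_singleton)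

/-- The quotient map is open, since the saturation of `U` is the union of `U` and its swap. Second
countability is what makes the complement of the support of a measure null. -/
lemma secondCountableTopology_sym2 (X : Type*) [TopologicalSpace X] [SecondCountableTopology X] :
    @SecondCountableTopology (Sym2 X) (sym2Topology X) := by
  let _ := sym2Topology X
  have hq : IsQuotientMap (fun q : X × X => s(q.1, q.2)) :=
    ⟨⟨rfl⟩, fun z => Sym2.ind (fun a b => ⟨(a, b), rfl⟩) z⟩
  refine hq.secondCountableTopology fun U hU => ?_
  rw [← hq.isOpen_preimage]
  have : (fun q : X × X => s(q.1, q.2)) ⁻¹' ((fun q : X × X => s(q.1, q.2)) '' U)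
      = U ∪ Prod.swap ⁻¹' U := by
    ext ⟨u, v⟩
    simp only [Set.mem_preimage, Set.mem_image, Prod.exists, Sym2.eq_iff, Set.mem_union,
      Prod.swap_prod_mk]
    constructor
    · rintro ⟨a, b, hab, ⟨rfl, rfl⟩ | ⟨rfl, rfl⟩⟩
      · exact .inl hab
      · exact .inr hab
    · rintro (hU | hU)
      · exact ⟨u, v, hU, .inl ⟨rfl, rfl⟩⟩
      · exact ⟨v, u, hU, .inr ⟨rfl, rfl⟩⟩
  rw [this]
  exact hU.union (hU.preimage continuous_swap)

namespace HyperbolicMetric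

variable {S : Type*} [TopologicalSpace S] {h : HyperbolicMetric S}

instance : SecondCountableTopology h.Geodesics := by
  let _ := sym2Topology (OnePoint ℝ)
  have := secondCountableTopology_sym2 (OnePoint ℝ)
  exact TopologicalSpace.secondCountableTopology_induced h.Geodesics (Sym2 (OnePoint ℝ)) Subtype.val

lemma moebiusAtInfinity_mem_idealBoundary {γ : SL(2, ℝ)} (hγ : γ ∈ h.deck) {ξ : OnePoint ℝ}
    (hξ : ξ ∈ h.idealBoundary) : moebiusAtInfinity γ ξ ∈ h.idealBoundary :=
  circleToSphere_smul_mem_closure γ (h.smul_mem_cover γ hγ) hξ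

/-- The action of the deck transformations on geodesics. -/
noncomputable def deckSmul {γ : SL(2, ℝ)} (hγ : γ ∈ h.deck) (p : h.Geodesics) : h.Geodesics :=
  ⟨Sym2.map (moebiusAtInfinity γ) p.val,
    fun hd => p.2.1 ((Sym2.isDiag_map (moebiusAtInfinity_injective γ)).1 hd), by
    intro ξ hξ
    obtain ⟨ζ, hζ, rfl⟩ := Sym2.mem_map.1 hξ
    exact moebiusAtInfinity_mem_idealBoundary hγ (p.2.2 ζ hζ)⟩

variable (h) in
/-- The geodesics from the endpoint `g ∞` of the line `g • axis` to a point `g x`, `|x| ≤ r`. -/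
def fan (g : SL(2, ℝ)) (r : ℝ) : Set h.Geodesics :=
  {p | ∃ x : ℝ, |x| ≤ r ∧
    p.val = s(moebiusAtInfinity g OnePoint.infty, moebiusAtInfinity g (x : OnePoint ℝ))}

lemma isClosed_fan (g : SL(2, ℝ)) (r : ℝ) : IsClosed (h.fan g r) := by
  have hc : Continuous fun x : ℝ => moebiusAtInfinity g (x : OnePoint ℝ) :=
    (continuous_moebiusAtInfinity g).comp OnePoint.continuous_coe
  have hK : IsClosed ((fun x : ℝ => moebiusAtInfinity g (x : OnePoint ℝ)) '' Set.Icc (-r) r) :=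
    (isCompact_Icc.image hc).isClosed
  refine isClosed_induced_iff.2 ⟨_, isClosed_sym2_pencil (moebiusAtInfinity g OnePoint.infty) hK, ?_⟩
  ext p
  change (∃ y ∈ _, p.val = _) ↔ p ∈ h.fan g r
  simp [fan, abs_le]

lemma fan_mono (g : SL(2, ℝ)) : Monotone (h.fan g) := fun _ _ hrs _ ⟨x, hx, hp⟩ =>
  ⟨x, hx.trans hrs, hp⟩

/-- The second endpoint varies continuously with `x`. Together with local finiteness this gives
small fans finite measure. -/
lemma exists_fan_subset {g : SL(2, ℝ)} {β : h.Geodesics}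
    (hβ : β.val = s(moebiusAtInfinity g OnePoint.infty,
      moebiusAtInfinity g ((0 : ℝ) : OnePoint ℝ)))
    {N : Set h.Geodesics} (hN : N ∈ 𝓝 β) : ∃ ε > 0, h.fan g ε ⊆ N := by
  let _ := sym2Topology (OnePoint ℝ)
  obtain ⟨O, hO, hON⟩ := (mem_nhds_induced (Subtype.val : h.Geodesics → _) β N).1 hN
  rw [hβ] at hO
  have hc : Continuous fun x : ℝ => s(moebiusAtInfinity g OnePoint.infty,
      moebiusAtInfinity g (x : OnePoint ℝ)) := by
    have h1 : Continuous fun q : OnePoint ℝ × OnePoint ℝ => s(q.1, q.2) :=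
      continuous_coinduced_rng
    exact h1.comp (continuous_const.prodMk
      ((continuous_moebiusAtInfinity g).comp OnePoint.continuous_coe))
  obtain ⟨ε, hε, hεO⟩ := Metric.nhds_basis_closedBall.mem_iff.1 (hc.tendsto 0 hO)
  refine ⟨ε, hε, ?_⟩
  rintro p ⟨x, hx, hp⟩
  apply hON
  change p.val ∈ O
  rw [hp]
  exact hεO (by simpa using hx)

lemma frontierLines_ends_mem_idealBoundary {g : SL(2, ℝ)} (hg : g ∈ h.frontierLines) :
    moebiusAtInfinity g OnePoint.infty ∈ h.idealBoundary ∧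
      moebiusAtInfinity g ((0 : ℝ) : OnePoint ℝ) ∈ h.idealBoundary :=
  ⟨mem_closure_of_tendsto (tendsto_smul_axis_atTop g)
    (Eventually.of_forall fun t => ⟨_, h.frontier_subset (hg t), rfl⟩),
  mem_closure_of_tendsto (tendsto_smul_axis_atBot g)
    (Eventually.of_forall fun t => ⟨_, h.frontier_subset (hg t), rfl⟩)⟩

lemma moebiusAtInfinity_infty_ne_coe (g : SL(2, ℝ)) (x : ℝ) :
    moebiusAtInfinity g OnePoint.infty ≠ moebiusAtInfinity g (x : OnePoint ℝ) := fun he =>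
  OnePoint.infty_ne_coe x (moebiusAtInfinity_injective g he)

/-- The geodesic of the universal cover parametrized by a line in the frontier. -/
noncomputable def frontierGeodesic {g : SL(2, ℝ)} (hg : g ∈ h.frontierLines) : h.Geodesics :=
  ⟨s(moebiusAtInfinity g OnePoint.infty, moebiusAtInfinity g ((0 : ℝ) : OnePoint ℝ)),
    fun hd => moebiusAtInfinity_infty_ne_coe g 0 (Sym2.mk_isDiag_iff.1 hd), by
    intro ξ hξ
    rcases Sym2.mem_iff.1 hξ with rfl | rfl
    · exact (frontierLines_ends_mem_idealBoundary hg).1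
    · exact (frontierLines_ends_mem_idealBoundary hg).2⟩

lemma isProjectionOf_smul_axis {g : SL(2, ℝ)} (hg : ∀ t, g • axis t ∈ h.cover) {p : h.Geodesics}
    (hp : p.val = s(moebiusAtInfinity g OnePoint.infty,
      moebiusAtInfinity g ((0 : ℝ) : OnePoint ℝ))) :
    h.IsProjectionOf (fun t => h.proj ⟨g • axis t, hg t⟩) p :=
  ⟨fun t => ⟨g • axis t, hg t⟩, ⟨fun s t => isometry_smul_axis g s t, fun _ => rfl⟩,
    isometry_smul_axis g, _, _, hp.trans Sym2.eq_swap, tendsto_smul_axis_atBot g,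
    tendsto_smul_axis_atTop g⟩

lemma isBoundaryCurve_smul_axis {g : SL(2, ℝ)} (hg : g ∈ h.frontierLines) :
    h.IsBoundaryCurve fun t => h.proj ⟨g • axis t, h.frontier_subset (hg t)⟩ := by
  refine ⟨⟨fun t => ⟨g • axis t, h.frontier_subset (hg t)⟩,
    fun s t => isometry_smul_axis g s t, fun _ => rfl⟩, ?_⟩
  rintro _ ⟨t, rfl⟩
  exact ⟨⟨g • axis t, h.frontier_subset (hg t)⟩, hg t, rfl⟩

/-- All lifts of a boundary curve lie in the frontier of the universal cover. -/
lemma IsGeodesicLift.mem_frontier {σ : ℝ → h.cover} {η : ℝ → S} (hσ : h.IsGeodesicLift σ η)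
    (hη : h.IsBoundaryCurve η) (t : ℝ) : (σ t : ℍ) ∈ frontier h.cover := by
  obtain ⟨x, hx, hxt⟩ := hη.2 ⟨t, rfl⟩
  obtain ⟨γ, hγ, hγx⟩ := (h.proj_eq_iff x (σ t)).1 (hxt.trans (hσ.2 t).symm)
  rw [← hγx]
  exact h.smul_mem_frontier hγ hx

/-- Two lifts of a geodesic differ by a deck transformation. -/
lemma IsGeodesicLift.exists_smul_eq {σ τ : ℝ → h.cover} {η : ℝ → S} (hσ : h.IsGeodesicLift σ η)
    (hτ : h.IsGeodesicLift τ η) : ∃ γ ∈ h.deck, ∀ t, (τ t : ℍ) = γ • (σ t : ℍ) := by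
  obtain ⟨γ, hγ, hγ0⟩ := (h.proj_eq_iff (σ 0) (τ 0)).1 ((hσ.2 0).trans (hτ.2 0).symm)
  set ρ : ℝ → h.cover := fun t => ⟨γ • (σ t : ℍ), h.smul_mem_cover γ hγ _ (σ t).2⟩ with hρ
  have hρc : Continuous ρ :=
    ((continuous_const_smul γ).comp (continuous_subtype_val.comp hσ.1.continuous)).subtype_mk _
  have hproj : h.proj ∘ τ = h.proj ∘ ρ := by
    funext t
    refine ((hτ.2 t).trans (hσ.2 t).symm).trans ?_
    exact (h.proj_eq_iff _ _).2 ⟨γ, hγ, rfl⟩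
  -- Uniqueness of lifts: both curves cover the same curve and agree at `0`.
  have heq := h.isCoveringMap_proj.eq_of_comp_eq hτ.1.continuous hρc hproj 0
    (Subtype.ext hγ0.symm)
  exact ⟨γ, hγ, fun t => congrArg Subtype.val (congrFun heq t)⟩

end HyperbolicMetric

/-! ### Internal currents do not charge the ends of boundary curves -/

namespace GeodesicCurrent

open HyperbolicMetric

variable {S : Type*} [TopologicalSpace S] {h : HyperbolicMetric S}

lemma measure_frontierGeodesic {c : GeodesicCurrent h} (hc : c.IsInternal) {g : SL(2, ℝ)}
    (hg : g ∈ h.frontierLines) : c.measure {frontierGeodesic hg} = 0 :=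
  hc _ _ (isBoundaryCurve_smul_axis hg) (isProjectionOf_smul_axis _ rfl)

/-- `δ` fixes the common endpoint and multiplies the other coordinate by `k`, so it carries one fan
onto the other. Surjectivity uses `δ⁻¹`, which keeps the endpoints in the ideal boundary. -/
lemma measure_fan_mul (c : GeodesicCurrent h) {g δ : SL(2, ℝ)} (hδ : δ ∈ h.deck) {k : ℝ}
    (hk : 0 < k)
    (hinf : moebiusAtInfinity δ (moebiusAtInfinity g OnePoint.infty) =
      moebiusAtInfinity g OnePoint.infty)
    (hmul : ∀ x : ℝ, moebiusAtInfinity δ (moebiusAtInfinity g (x : OnePoint ℝ)) =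
      moebiusAtInfinity g ((k * x : ℝ) : OnePoint ℝ)) (r : ℝ) :
    c.measure (h.fan g (k * r)) = c.measure (h.fan g r) := by
  refine c.invariant δ hδ _ _ (isClosed_fan g _).measurableSet (isClosed_fan g _).measurableSet ?_
  ext q
  constructor
  · rintro ⟨p, ⟨x, hx, hp⟩, rfl⟩
    have hx' : x = k * (x / k) := by field_simp
    have hq : Sym2.map (moebiusAtInfinity δ⁻¹) p.val = s(moebiusAtInfinity g OnePoint.infty,
        moebiusAtInfinity g ((x / k : ℝ) : OnePoint ℝ)) := by
      rw [hp, Sym2.map_mk, hx', ← hmul]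
      nth_rw 1 [← hinf]
      simp [hk.ne']
    refine ⟨_, ⟨deckSmul (inv_mem hδ) p, ⟨x / k, ?_, hq⟩, rfl⟩, ?_⟩
    · rw [abs_div, abs_of_pos hk, div_le_iff₀ hk]
      linarith
    · change Sym2.map _ (Sym2.map _ p.val) = p.val
      rw [hq, Sym2.map_mk, hinf, hmul, ← hx', hp]
  · rintro ⟨_, ⟨p, ⟨x, hx, hp⟩, rfl⟩, rfl⟩
    refine ⟨deckSmul hδ p, ⟨k * x, ?_, ?_⟩, rfl⟩
    · rw [abs_mul, abs_of_pos hk]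
      gcongr
    · change Sym2.map _ p.val = _
      rw [hp, Sym2.map_mk, hinf, hmul]

variable [CompactSpace S]

/-- The fans of radius `kⁿ r` all have the same measure and shrink to the frontier line. Continuity
from above identifies that measure with the mass of the line, which is zero. -/
lemma measure_fan {c : GeodesicCurrent h} (hc : c.IsInternal) {g : SL(2, ℝ)}
    (hg : g ∈ h.frontierLines) (r : ℝ) (hr : 0 ≤ r) : c.measure (h.fan g r) = 0 := by
  obtain ⟨δ, hδ, k, hk0, hk1, hinf, hmul⟩ := exists_deck_homothety hg
  have hconst : ∀ n : ℕ, c.measure (h.fan g (k ^ n * r)) = c.measure (h.fan g r) := by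
    intro n
    induction n with
    | zero => simp
    | succ n ih => rw [pow_succ', mul_assoc, c.measure_fan_mul hδ hk0 hinf hmul, ih]
  have hlim : Tendsto (fun n : ℕ => k ^ n * r) atTop (𝓝 0) := by
    simpa using (tendsto_pow_atTop_nhds_zero_of_lt_one hk0.le hk1).mul_const r
  -- Continuity from above needs one set of finite measure; local finiteness at the frontier line
  -- provides it.
  have hfin : ∃ n : ℕ, c.measure (h.fan g (k ^ n * r)) ≠ ⊤ := by
    have := c.locallyFinite
    obtain ⟨N, hN, hNfin⟩ := c.measure.finiteAt_nhds (frontierGeodesic hg)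
    obtain ⟨ε, hε, hεN⟩ := exists_fan_subset rfl hN
    obtain ⟨n, hn⟩ := (hlim.eventually_lt_const hε).exists
    exact ⟨n, ((measure_mono ((fan_mono g hn.le).trans hεN)).trans_lt hNfin).ne⟩
  have hanti : Antitone fun n : ℕ => h.fan g (k ^ n * r) := fun m n hmn =>
    fan_mono g (mul_le_mul_of_nonneg_right (pow_le_pow_of_le_one hk0.le hk1.le hmn) hr)
  have htend := tendsto_measure_iInter_atTop (μ := c.measure)
    (fun n => (isClosed_fan (h := h) g (k ^ n * r)).measurableSet.nullMeasurableSet) hanti hfin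
  simp only [Function.comp_def, hconst] at htend
  rw [tendsto_nhds_unique tendsto_const_nhds htend]
  refine measure_mono_null ?_ (measure_frontierGeodesic hc hg)
  intro p hp
  rw [Set.mem_iInter] at hp
  obtain ⟨x, -, hpx⟩ := hp 0
  have hx : ∀ n : ℕ, |x| ≤ k ^ n * r := by
    intro n
    obtain ⟨y, hy, hpy⟩ := hp n
    rw [hpx, Sym2.congr_right] at hpy
    rwa [OnePoint.coe_injective (moebiusAtInfinity_injective g hpy)]
  have hx0 : x = 0 := abs_nonpos_iff.1 (ge_of_tendsto' hlim hx)
  exact Subtype.ext (by rw [hpx, hx0]; rfl)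

/-- The geodesics sharing an endpoint with a boundary line form a null set. -/
lemma measure_pencil {c : GeodesicCurrent h} (hc : c.IsInternal) {ξ : OnePoint ℝ}
    (hξ : ξ ∈ h.frontierEnds) : c.measure {p : h.Geodesics | ξ ∈ p.val} = 0 := by
  obtain ⟨g, hg, rfl⟩ := hξ
  refine measure_mono_null ?_ (measure_iUnion_null fun n : ℕ => measure_fan hc hg n n.cast_nonneg)
  intro p hp
  obtain ⟨y, hy⟩ := Sym2.mem_iff_exists.1 hp
  obtain ⟨z, rfl⟩ : ∃ z, y = moebiusAtInfinity g z := ⟨moebiusAtInfinity g⁻¹ y, by simp⟩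
  induction z using OnePoint.rec with
  | infty => exact absurd (by rw [hy]; exact Sym2.mk_isDiag_iff.2 rfl) p.2.1
  | coe x =>
    obtain ⟨n, hn⟩ := exists_nat_ge |x|
    exact Set.mem_iUnion.2 ⟨n, x, hn, hy⟩

lemma exists_mem_support_forall_notMem_frontierEnds {c : GeodesicCurrent h} (hc : c.IsInternal)
    (hne : c.measure ≠ 0) : ∃ p ∈ c.measure.support, ∀ ξ ∈ p.val, ξ ∉ h.frontierEnds := by
  by_contra! hcon
  apply hne
  rw [← Measure.measure_univ_eq_zero, ← Set.union_compl_self c.measure.support]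
  refine measure_union_null (measure_mono_null ?_
    ((measure_biUnion_null_iff countable_frontierEnds).2 fun ξ hξ => measure_pencil hc hξ))
    Measure.measure_compl_support
  intro p hp
  obtain ⟨ξ, hξp, hξ⟩ := hcon p hp
  exact Set.mem_iUnion₂.2 ⟨ξ, hξ, hξp⟩

end GeodesicCurrent

/-! ### ### A support geodesic not asymptotic to the boundary -/

open HyperbolicMetric in
theorem mainTheorem4 {S : Type*} [TopologicalSpace S] [CompactSpace S]
    (h : HyperbolicMetric S) (c : GeodesicCurrent h) (hc : c.IsInternal)
    (hne : c.measure ≠ 0) :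
    ∃ p ∈ c.measure.support, ∃ η : ℝ → S, h.IsProjectionOf η p ∧
      Set.range η ⊆ c.supp ∧
      ¬ h.IsBoundaryCurve η ∧
      ∀ β : ℝ → S, h.IsBoundaryCurve β → ¬ h.Asymptotic η β := by
  obtain ⟨p, hp, hpE⟩ := GeodesicCurrent.exists_mem_support_forall_notMem_frontierEnds hc hne
  obtain ⟨ξ, η, hpq⟩ : ∃ ξ η, p.val = s(ξ, η) := Sym2.ind (fun a b => ⟨a, b, rfl⟩) p.val
  have hξη : η ≠ ξ := by
    rintro rfl
    exact p.2.1 (by rw [hpq]; exact Sym2.mk_isDiag_iff.2 rfl)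
  obtain ⟨g, hg0, hg1⟩ := exists_moebiusAtInfinity_zero_infty hξη
  rw [← hg0, ← hg1] at hpq
  have h1 := p.2.2 (moebiusAtInfinity g OnePoint.infty) (by rw [hpq]; exact Sym2.mem_mk_left _ _)
  have h0 := p.2.2 (moebiusAtInfinity g ((0 : ℝ) : OnePoint ℝ))
    (by rw [hpq]; exact Sym2.mem_mk_right _ _)
  have hconv : GeodesicallyConvex h.cover := h.convex_cover
  have hgc : ∀ t, g • axis t ∈ h.cover := hconv.smul_axis_mem h.isClosed_cover h0 h1
  have hproj := isProjectionOf_smul_axis hgc hpq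
  have hlift : h.IsGeodesicLift (fun t => ⟨g • axis t, hgc t⟩)
      (fun t => h.proj ⟨g • axis t, hgc t⟩) :=
    ⟨fun s t => isometry_smul_axis g s t, fun _ => rfl⟩
  have hasym : ∀ β : ℝ → S, h.IsBoundaryCurve β →
      ¬ h.Asymptotic (fun t => h.proj ⟨g • axis t, hgc t⟩) β := by
    rintro β hβ ⟨σ, τ, hσ, hτ, ζ, hζσ, hζτ⟩
    have hζ : ζ ∈ h.frontierEnds :=
      mem_frontierEnds_of_isEndAtInfinity (fun s t => hτ.1 s t) (hτ.mem_frontier hβ) hζτ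
    -- Asymptoticity may be witnessed by a different lift of the projected geodesic. Moving back by
    -- `γ⁻¹` makes the shared end an end of `p`, and the frontier ends are invariant under the deck
    -- group.
    obtain ⟨γ, hγ, hγσ⟩ := hlift.exists_smul_eq hσ
    simp only [hγσ, ← mul_smul] at hζσ
    have hζ' := moebiusAtInfinity_mem_frontierEnds (inv_mem hγ) hζ
    refine hpE (moebiusAtInfinity γ⁻¹ ζ) ?_ hζ'
    rw [hpq, Sym2.mem_iff]
    rcases isEndAtInfinity_smul_axis_iff.1 hζσ with rfl | rfl
    · left; simp [moebiusAtInfinity_mul]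
    · right; simp [moebiusAtInfinity_mul]
  refine ⟨p, hp, _, hproj, fun s hs => ⟨p, hp, _, hproj, hs⟩, fun hb => ?_, hasym⟩
  -- A boundary curve would be asymptotic to itself.
  exact hasym _ hb ⟨_, _, hlift, hlift, _, isEndAtInfinity_smul_axis_iff.2 (.inl rfl),
    isEndAtInfinity_smul_axis_iff.2 (.inl rfl)⟩
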